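/- Let $n\ge 4$ and let $C_n\subset\mathbb{P}^n$ be the rational normal curve over $\mathbb{C}$, parametrized by $\nu_n(s:t)=(s^n:s^{n-1}t:\dots:t^n)$. Let $L\subset\mathbb{P}^n$ be a line with $L\cap C_n=\emptyset$, so that the projection $\pi_L:\mathbb{P}^n\dashrightarrow\mathbb{P}^{n-2}$ from $L$ gives a parametrized rational curve $\pi_L\circ\nu_n:\mathbb{P}^1\to\mathbb{P}^{n-2}$ of degree $n$, with image $\pi_L(C_n)$. Its normal bundle $N_{\pi_L(C_n),\mathbb{P}^{n-2}}$, a sheaf on $\mathbb{P}^1$, is the cokernel of the map $\mathcal{O}_{\mathbb{P}^1}(1)^{2}\to\mathcal{O}_{\mathbb{P}^1}(n)^{n-1}$ given by the Jacobian matrix of the $n-1$ forms of degree $n$ in $s,t$ that define $\pi_L\circ\nu_n$. For a basis $a^1,a^2\in\mathbb{C}^{n+1}$ of the vector space of $L$, let $N^L_{n,2}$ be the $6\times(n-1)$ matrix whose rows are $(a^j_i)_{0\le i\le n-2}$, $(-2a^j_{i+1})_{0\le i\le n-2}$, $(a^j_{i+2})_{0\le i\le n-2}$ for $j=1,2$ (the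 matrix on global sections of the map $\mathcal{O}^{n-1}\to\mathcal{O}(2)^2$ with entries $a^j_it^2-2a^j_{i+1}ts+a^j_{i+2}s^2$). **Theorem (case of rank 3).** Suppose that $L$ is contained in a $3$-secant plane of $C_n$, i.e. a plane $\mathbb{P}^2$ spanned by three distinct points of $C_n$, and that $L$ is not a secant line of $C_n$, i.e. not spanned by two distinct points of $C_n$. Then $$N_{\pi_L(C_n),\mathbb{P}^{n-2}}\;\cong\;\mathcal{O}_{\mathbb{P}^1}(n+2)^{\,n-4}\oplus\mathcal{O}_{\mathbb{P}^1}(n+6),$$ that is, the splitting type is $((n+2)^{n-4},n+6)$; moreover $\operatorname{rank}N^L_{n,2}=3$ for every choice of the basis $a^1,a^2$. -/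

import Mathlib

open scoped Polynomial LaurentPolynomial LinearAlgebra.Projectivization

noncomputable section

/-! ## Quasi-coherent sheaves on the complex projective line

`ℙ¹` has homogeneous coordinates `(s, t)`. It is covered by the affine lines `U₀ = {s ≠ 0}`, with
coordinate `x = t / s`, and `U₁ = {t ≠ 0}`, with coordinate `y = s / t = x⁻¹`; their intersection
`U₀₁` has coordinate ring `ℂ[x, x⁻¹]`. -/

/-- Restriction of functions from `U₁` to `U₀₁`: a polynomial `q(y)` goes to `q(x⁻¹)`. -/
def restrictOne : ℂ[X] →+* ℂ[T;T⁻¹] :=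
  (LaurentPolynomial.invert (R := ℂ) : ℂ[T;T⁻¹] →+* ℂ[T;T⁻¹]).comp Polynomial.toLaurent

/-- A quasi-coherent sheaf on `ℙ¹`, given by its modules of sections over `U₀`, `U₁` and `U₀₁` and
the restriction maps; the last four fields say that the sections over `U₀₁` are the localization
of the sections over `U₀` at `x`, and of the sections over `U₁` at `y`. -/
structure SheafP1 where
  /-- sections over `U₀` -/
  A : Type
  /-- sections over `U₁` -/
  B : Type
  /-- sections over `U₀₁` -/
  C : Type
  [groupA : AddCommGroup A]
  [groupB : AddCommGroup B]
  [groupC : AddCommGroup C]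
  [moduleA : Module ℂ[X] A]
  [moduleB : Module ℂ[X] B]
  [moduleC : Module ℂ[T;T⁻¹] C]
  resA : A →ₛₗ[(Polynomial.toLaurent : ℂ[X] →+* ℂ[T;T⁻¹])] C
  resB : B →ₛₗ[restrictOne] C
  surjA : ∀ c : C, ∃ (k : ℕ) (a : A), (LaurentPolynomial.T (k : ℤ) : ℂ[T;T⁻¹]) • c = resA a
  surjB : ∀ c : C, ∃ (k : ℕ) (b : B), (LaurentPolynomial.T (-(k : ℤ)) : ℂ[T;T⁻¹]) • c = resB b
  kerA : ∀ a : A, resA a = 0 → ∃ k : ℕ, (Polynomial.X ^ k : ℂ[X]) • a = 0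
  kerB : ∀ b : B, resB b = 0 → ∃ k : ℕ, (Polynomial.X ^ k : ℂ[X]) • b = 0

namespace SheafP1

attribute [instance] groupA groupB groupC moduleA moduleB moduleC

/-- A morphism of quasi-coherent sheaves on `ℙ¹`. -/
structure Hom (E F : SheafP1) where
  mapA : E.A →ₗ[ℂ[X]] F.A
  mapB : E.B →ₗ[ℂ[X]] F.B
  mapC : E.C →ₗ[ℂ[T;T⁻¹]] F.C
  commA : ∀ a, F.resA (mapA a) = mapC (E.resA a)
  commB : ∀ b, F.resB (mapB b) = mapC (E.resB b)

/-- An isomorphism of quasi-coherent sheaves on `ℙ¹`. -/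
structure Iso (E F : SheafP1) where
  equivA : E.A ≃ₗ[ℂ[X]] F.A
  equivB : E.B ≃ₗ[ℂ[X]] F.B
  equivC : E.C ≃ₗ[ℂ[T;T⁻¹]] F.C
  commA : ∀ a, F.resA (equivA a) = equivC (E.resA a)
  commB : ∀ b, F.resB (equivB b) = equivC (E.resB b)

lemma restrictOne_X_pow (k : ℕ) :
    restrictOne (Polynomial.X ^ k) = LaurentPolynomial.T (-(k : ℤ)) := by
  simp [restrictOne]

/-- The cokernel of a morphism. Since `U₀`, `U₁`, `U₀₁` are affine, it is formed on sections. -/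
def coker {E F : SheafP1} (f : Hom E F) : SheafP1 where
  A := F.A ⧸ LinearMap.range f.mapA
  B := F.B ⧸ LinearMap.range f.mapB
  C := F.C ⧸ LinearMap.range f.mapC
  resA := Submodule.mapQ _ _ F.resA (by
    rintro _ ⟨a, rfl⟩
    exact ⟨E.resA a, (f.commA a).symm⟩)
  resB := Submodule.mapQ _ _ F.resB (by
    rintro _ ⟨a, rfl⟩
    exact ⟨E.resB a, (f.commB a).symm⟩)
  surjA := by
    intro c
    obtain ⟨c, rfl⟩ := Submodule.mkQ_surjective _ c
    obtain ⟨k, a, h⟩ := F.surjA c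
    refine ⟨k, Submodule.Quotient.mk a, ?_⟩
    simp only [Submodule.mkQ_apply, Submodule.mapQ_apply, ← h, Submodule.Quotient.mk_smul]
  surjB := by
    intro c
    obtain ⟨c, rfl⟩ := Submodule.mkQ_surjective _ c
    obtain ⟨k, a, h⟩ := F.surjB c
    refine ⟨k, Submodule.Quotient.mk a, ?_⟩
    simp only [Submodule.mkQ_apply, Submodule.mapQ_apply, ← h, Submodule.Quotient.mk_smul]
  kerA := by
    intro a ha
    obtain ⟨a, rfl⟩ := Submodule.mkQ_surjective _ a
    simp only [Submodule.mkQ_apply, Submodule.mapQ_apply, Submodule.Quotient.mk_eq_zero] at ha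
    obtain ⟨c, hc⟩ := ha
    obtain ⟨k, e, he⟩ := E.surjA c
    have h0 : F.resA ((Polynomial.X ^ k : ℂ[X]) • a - f.mapA e) = 0 := by
      rw [map_sub, LinearMap.map_smulₛₗ, f.commA, ← he, map_smul, hc, map_pow,
        Polynomial.toLaurent_X, LaurentPolynomial.T_pow, mul_one, sub_self]
    obtain ⟨j, hj⟩ := F.kerA _ h0
    refine ⟨j + k, ?_⟩
    rw [Submodule.mkQ_apply, ← Submodule.Quotient.mk_smul, Submodule.Quotient.mk_eq_zero]
    refine ⟨(Polynomial.X ^ j : ℂ[X]) • e, ?_⟩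
    rw [smul_sub, sub_eq_zero, smul_smul, ← pow_add] at hj
    rw [map_smul, hj]
  kerB := by
    intro a ha
    obtain ⟨a, rfl⟩ := Submodule.mkQ_surjective _ a
    simp only [Submodule.mkQ_apply, Submodule.mapQ_apply, Submodule.Quotient.mk_eq_zero] at ha
    obtain ⟨c, hc⟩ := ha
    obtain ⟨k, e, he⟩ := E.surjB c
    have h0 : F.resB ((Polynomial.X ^ k : ℂ[X]) • a - f.mapB e) = 0 := by
      rw [map_sub, LinearMap.map_smulₛₗ, f.commB, ← he, map_smul, hc, restrictOne_X_pow, sub_self]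
    obtain ⟨j, hj⟩ := F.kerB _ h0
    refine ⟨j + k, ?_⟩
    rw [Submodule.mkQ_apply, ← Submodule.Quotient.mk_smul, Submodule.Quotient.mk_eq_zero]
    refine ⟨(Polynomial.X ^ j : ℂ[X]) • e, ?_⟩
    rw [smul_sub, sub_eq_zero, smul_smul, ← pow_add] at hj
    rw [map_smul, hj]

lemma exists_T_mul (f : ℂ[T;T⁻¹]) :
    ∃ k : ℕ, ∀ l : ℕ, k ≤ l →
      ∃ p : ℂ[X], Polynomial.toLaurent p = LaurentPolynomial.T (l : ℤ) * f := by
  obtain ⟨k, p, h⟩ := LaurentPolynomial.exists_T_pow f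
  refine ⟨k, fun l hl => ⟨Polynomial.X ^ (l - k) * p, ?_⟩⟩
  rw [map_mul, map_pow, Polynomial.toLaurent_X, h, LaurentPolynomial.T_pow, mul_one, mul_comm f,
    ← mul_assoc, ← LaurentPolynomial.T_add]
  congr 2
  omega

lemma restrictOne_injective : Function.Injective restrictOne := by
  intro p q h
  exact Polynomial.toLaurent_injective ((LaurentPolynomial.invert (R := ℂ)).injective h)

/-- The sheaf `⨁ i, 𝒪(d i)` on `ℙ¹`. A section of `𝒪(d)` over `U₀` is `s ^ d * p(t / s)`, a section
over `U₁` is `t ^ d * q(s / t)`, a section over `U₀₁` is `s ^ d * f(t / s)` with `f` a Laurent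
polynomial; so the section `t ^ d * q(s / t)` over `U₁` restricts to `f(x) = x ^ d * q(x⁻¹)`. -/
def lineBundleSum {ι : Type} [Fintype ι] (d : ι → ℤ) : SheafP1 where
  A := ι → ℂ[X]
  B := ι → ℂ[X]
  C := ι → ℂ[T;T⁻¹]
  resA :=
    { toFun := fun p i => Polynomial.toLaurent (p i)
      map_add' := fun p q => by ext1 i; simp
      map_smul' := fun c p => by ext1 i; simp }
  resB :=
    { toFun := fun q i => LaurentPolynomial.T (d i) * restrictOne (q i)
      map_add' := fun p q => by ext1 i; simp [mul_add]
      map_smul' := fun c p => by ext1 i; simp [mul_assoc] }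
  surjA := by
    intro c
    choose k hk using fun i => exists_T_mul (c i)
    have hle : ∀ i, k i ≤ Finset.univ.sup k := fun i => Finset.le_sup (Finset.mem_univ i)
    choose p hp using fun i => hk i _ (hle i)
    exact ⟨Finset.univ.sup k, p, by ext1 i; exact (hp i).symm⟩
  surjB := by
    intro c
    choose k hk using fun i => exists_T_mul
      (LaurentPolynomial.invert (LaurentPolynomial.T (-d i) * c i))
    have hle : ∀ i, k i ≤ Finset.univ.sup k := fun i => Finset.le_sup (Finset.mem_univ i)
    choose p hp using fun i => hk i _ (hle i)
    refine ⟨Finset.univ.sup k, p, ?_⟩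
    ext1 i
    have h : restrictOne (p i) = LaurentPolynomial.T (-((Finset.univ.sup k : ℕ) : ℤ)) *
        (LaurentPolynomial.T (-d i) * c i) := by
      show LaurentPolynomial.invert (Polynomial.toLaurent (p i)) = _
      rw [hp i, map_mul, LaurentPolynomial.invert_T]
      congr 1
      exact LaurentPolynomial.involutive_invert _
    show _ = LaurentPolynomial.T (d i) * restrictOne (p i)
    rw [h, mul_left_comm, ← mul_assoc (LaurentPolynomial.T (d i)), ← LaurentPolynomial.T_add,
      add_neg_cancel, LaurentPolynomial.T_zero, one_mul]
    rfl
  kerA := by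
    intro a ha
    refine ⟨0, ?_⟩
    rw [pow_zero, one_smul]
    ext1 i
    exact Polynomial.toLaurent_injective ((congrFun ha i).trans (map_zero _).symm)
  kerB := by
    intro b hb
    refine ⟨0, ?_⟩
    rw [pow_zero, one_smul]
    ext1 i
    apply restrictOne_injective
    have h : LaurentPolynomial.T (d i) * restrictOne (b i) = 0 := congrFun hb i
    have h' := congrArg (LaurentPolynomial.T (-d i) * ·) h
    simp only [← mul_assoc, ← LaurentPolynomial.T_add, neg_add_cancel, LaurentPolynomial.T_zero,
      one_mul, mul_zero] at h'
    exact h'.trans (map_zero _).symm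

/-- `E` has splitting type `(d i)ᵢ`: it is isomorphic to `⨁ i, 𝒪(d i)`. -/
def HasSplittingType (E : SheafP1) {ι : Type} [Fintype ι] (d : ι → ℤ) : Prop :=
  Nonempty (Iso E (lineBundleSum d))

end SheafP1

/-! ## Forms in `s, t` and the morphisms they define -/

/-- `g(1, x)`: a form on the chart `U₀`. -/
def chartZero (g : MvPolynomial (Fin 2) ℂ) : ℂ[X] := MvPolynomial.aeval ![1, Polynomial.X] g

/-- `g(y, 1)`: a form on the chart `U₁`. -/
def chartOne (g : MvPolynomial (Fin 2) ℂ) : ℂ[X] := MvPolynomial.aeval ![Polynomial.X, 1] g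

lemma chart_compat (g : MvPolynomial (Fin 2) ℂ) (e : ℕ) (hg : g.IsHomogeneous e) :
    Polynomial.toLaurent (chartZero g) = LaurentPolynomial.T (e : ℤ) * restrictOne (chartOne g) := by
  rw [g.as_sum]
  simp only [chartZero, chartOne, map_sum, Finset.mul_sum]
  refine Finset.sum_congr rfl fun m hm => ?_
  have hd : m 0 + m 1 = e := by
    have := hg (MvPolynomial.mem_support_iff.mp hm)
    simpa [Finsupp.weight_apply, Finsupp.sum_fintype] using this
  simp only [MvPolynomial.aeval_monomial, Finsupp.prod_fintype, Fin.prod_univ_two,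
    Matrix.cons_val_zero, Matrix.cons_val_one, one_pow, one_mul, mul_one, pow_zero, implies_true,
    map_mul, map_pow, Polynomial.toLaurent_X]
  rw [← map_pow restrictOne, SheafP1.restrictOne_X_pow, mul_left_comm, ← LaurentPolynomial.T_add]
  congr 1
  · simp [restrictOne]
  · rw [LaurentPolynomial.T_pow]
    congr 1
    push_cast [← hd]
    ring

/-- The morphism `𝒪(a) ^ ι ⟶ 𝒪(a + e) ^ κ` given by a `κ × ι` matrix of forms of degree `e`. -/
def SheafP1.Hom.ofForms {ι κ : Type} [Fintype ι] [Fintype κ] (a b : ℤ) (e : ℕ) (hab : b = a + e)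
    (G : Matrix κ ι (MvPolynomial (Fin 2) ℂ)) (hG : ∀ j i, (G j i).IsHomogeneous e) :
    SheafP1.Hom (SheafP1.lineBundleSum fun _ : ι => a)
      (SheafP1.lineBundleSum fun _ : κ => b) where
  mapA := Matrix.mulVecLin (G.map chartZero)
  mapB := Matrix.mulVecLin (G.map chartOne)
  mapC := Matrix.mulVecLin (G.map fun g => Polynomial.toLaurent (chartZero g))
  commA := by
    intro p
    refine funext fun j => ?_
    show Polynomial.toLaurent (Matrix.mulVec (G.map chartZero) p j) =
      Matrix.mulVec (G.map fun g => Polynomial.toLaurent (chartZero g))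
        (fun i => Polynomial.toLaurent (p i)) j
    simp [Matrix.mulVec, dotProduct]
  commB := by
    intro q
    refine funext fun j => ?_
    show LaurentPolynomial.T b * restrictOne (Matrix.mulVec (G.map chartOne) q j) =
      Matrix.mulVec (G.map fun g => Polynomial.toLaurent (chartZero g))
        (fun i => LaurentPolynomial.T a * restrictOne (q i)) j
    simp only [Matrix.mulVec, dotProduct, Matrix.map_apply, map_sum, map_mul, Finset.mul_sum]
    refine Finset.sum_congr rfl fun i _ => ?_
    rw [chart_compat _ e (hG j i), hab, LaurentPolynomial.T_add]
    ring

/-! ## Parametrized rational curves and their normal sheaf -/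

/-- A morphism `ℙ¹ ⟶ ℙ(ℂ ^ κ)` of degree `n > 0`: a family of forms of degree `n` in `s, t` that
have no common zero on `ℙ¹`. -/
structure RationalCurve (n : ℕ) (κ : Type) where
  form : κ → MvPolynomial (Fin 2) ℂ
  deg_pos : 0 < n
  homogeneous : ∀ j, (form j).IsHomogeneous n
  no_base_point : ∀ v : Fin 2 → ℂ, v ≠ 0 → ∃ j, MvPolynomial.eval v (form j) ≠ 0

/-- The normal sheaf of a parametrized rational curve of degree `n`: the cokernel of the map
`𝒪(1)² ⟶ 𝒪(n) ^ κ` given by the Jacobian matrix `(∂F_j/∂s, ∂F_j/∂t)`. By the Euler sequences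
it is the pullback of the tangent bundle of the projective space modulo that of `ℙ¹`. -/
def RationalCurve.normalSheaf {n : ℕ} {κ : Type} [Fintype κ] (F : RationalCurve n κ) : SheafP1 :=
  SheafP1.coker <| SheafP1.Hom.ofForms (ι := Fin 2) (κ := κ) 1 n (n - 1)
    (by have := F.deg_pos; omega)
    (Matrix.of fun j i => MvPolynomial.pderiv i (F.form j))
    (fun j _ => (F.homogeneous j).pderiv)

/-! ## The rational normal curve, multisecant spaces, projections

A linear subspace of `ℙⁿ` of (projective) dimension `r` is a `ℂ`-subspace of `ℂ^(n+1)` of dimension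
`r + 1`. -/

/-- The Veronese map `(s, t) ↦ (s ^ n, s ^ (n - 1) * t, …, t ^ n)`. -/
def veronese (n : ℕ) (v : Fin 2 → ℂ) : Fin (n + 1) → ℂ :=
  fun i => v 0 ^ (n - (i : ℕ)) * v 1 ^ (i : ℕ)

/-- The rational normal curve `C_n` in `ℙⁿ`. -/
def rationalNormalCurve (n : ℕ) : Set (ℙ ℂ (Fin (n + 1) → ℂ)) :=
  {p | ∃ v : Fin 2 → ℂ, v ≠ 0 ∧ p.submodule = Submodule.span ℂ {veronese n v}}

/-- `M` is an `r`-secant `ℙ^(r-1)` of `C_n`: it is of projective dimension `r - 1` and spanned by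
`r` distinct points of `C_n`. -/
def IsSecantSpace (n r : ℕ) (M : Submodule ℂ (Fin (n + 1) → ℂ)) : Prop :=
  Module.finrank ℂ M = r ∧ ∃ P : Finset (ℙ ℂ (Fin (n + 1) → ℂ)),
    P.card = r ∧ (P : Set (ℙ ℂ (Fin (n + 1) → ℂ))) ⊆ rationalNormalCurve n ∧
      M = ⨆ p ∈ P, p.submodule

/-- The linear space `L` contains no point of `C_n`. -/
def AvoidsCurve (n : ℕ) (L : Submodule ℂ (Fin (n + 1) → ℂ)) : Prop :=
  ∀ p ∈ rationalNormalCurve n, ¬ p.submodule ≤ L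

/-- The linear map `π` induces the projection from the centre `L`. -/
def IsProjectionFrom {n : ℕ} {κ : Type} (L : Submodule ℂ (Fin (n + 1) → ℂ))
    (π : (Fin (n + 1) → ℂ) →ₗ[ℂ] (κ → ℂ)) : Prop :=
  Function.Surjective π ∧ LinearMap.ker π = L

/-- The forms of degree `n` that are the coordinates of `π ∘ veronese n`. -/
def projectedForm {n : ℕ} {κ : Type} (π : (Fin (n + 1) → ℂ) →ₗ[ℂ] (κ → ℂ)) (j : κ) :
    MvPolynomial (Fin 2) ℂ :=
  ∑ i : Fin (n + 1), MvPolynomial.C (π (Pi.single i 1) j) *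
    (MvPolynomial.X 0 ^ (n - (i : ℕ)) * MvPolynomial.X 1 ^ (i : ℕ))

lemma eval_projectedForm {n : ℕ} {κ : Type} (π : (Fin (n + 1) → ℂ) →ₗ[ℂ] (κ → ℂ)) (j : κ)
    (v : Fin 2 → ℂ) : MvPolynomial.eval v (projectedForm π j) = π (veronese n v) j := by
  have h : veronese n v = ∑ i, veronese n v i • Pi.single i (1 : ℂ) := by
    simpa using pi_eq_sum_univ' (veronese n v)
  rw [h, map_sum, Finset.sum_apply]
  simp [projectedForm, veronese, mul_comm]

lemma veronese_ne_zero (n : ℕ) {v : Fin 2 → ℂ} (hv : v ≠ 0) : veronese n v ≠ 0 := by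
  intro h
  apply hv
  have h0 := congrFun h 0
  have h1 := congrFun h (Fin.last n)
  simp only [veronese, Fin.val_zero, Nat.sub_zero, pow_zero, mul_one, Pi.zero_apply, Fin.val_last,
    Nat.sub_self, one_mul] at h0 h1
  ext i
  fin_cases i
  · exact eq_zero_of_pow_eq_zero h0
  · exact eq_zero_of_pow_eq_zero h1

/-- The curve `π_L(C_n)`, parametrized by `π_L` composed with the Veronese map. -/
def projectedCurve {n : ℕ} (hn : 0 < n) {κ : Type} {L : Submodule ℂ (Fin (n + 1) → ℂ)}
    (hL : AvoidsCurve n L) (π : (Fin (n + 1) → ℂ) →ₗ[ℂ] (κ → ℂ)) (hπ : IsProjectionFrom L π) :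
    RationalCurve n κ where
  form := projectedForm π
  deg_pos := hn
  homogeneous := by
    intro j
    refine MvPolynomial.IsHomogeneous.sum _ _ _ fun i _ => ?_
    have h := ((MvPolynomial.isHomogeneous_X_pow (R := ℂ) (0 : Fin 2) (n - (i : ℕ))).mul
      (MvPolynomial.isHomogeneous_X_pow (R := ℂ) (1 : Fin 2) (i : ℕ)))
    have h2 := (MvPolynomial.isHomogeneous_C (Fin 2) (π (Pi.single i 1) j)).mul h
    have e : 0 + (n - (i : ℕ) + (i : ℕ)) = n := by omega
    rwa [e] at h2
  no_base_point := by
    intro v hv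
    by_contra! h
    have hmem : veronese n v ∈ L := by
      rw [← hπ.2, LinearMap.mem_ker]
      ext j
      rw [← eval_projectedForm, h j, Pi.zero_apply]
    refine hL (Projectivization.mk ℂ _ (veronese_ne_zero n hv))
      ⟨v, hv, Projectivization.submodule_mk _ _⟩ ?_
    rw [Projectivization.submodule_mk, Submodule.span_singleton_le_iff_mem]
    exact hmem

/-- The matrix `N^L_{n,k}` for a line or larger space `L` spanned by the vectors `a 0, …, a (k-1)`:
for every `j` it has the three rows `(a_i)`, `(-2 a_(i+1))`, `(a_(i+2))`, `0 ≤ i ≤ n - 2`, where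
`a = a j`. It is the matrix of the map on global sections of the map `𝒪 ^ (n-1) ⟶ 𝒪(2) ^ k` with
entries `a_i t² - 2 a_(i+1) t s + a_(i+2) s²`. -/
def normalMatrix {n k : ℕ} (a : Fin k → Fin (n + 1) → ℂ) :
    Matrix (Fin k × Fin 3) (Fin (n - 1)) ℂ :=
  Matrix.of fun jr i => ![1, -2, 1] jr.2 * a jr.1 ⟨(i : ℕ) + (jr.2 : ℕ), by omega⟩

end

/-! Write `n = d + 4`. Let `q` be the binary cubic whose roots are the three points spanning the
plane `M`, and let `m_j` be the `d + 2` monomials of degree `d + 1`. Linear forms on `ℂ^(n+1)` are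
binary forms of degree `n`; those vanishing on `M` are the multiples of `q`, and `L` is cut out of
`M` by one further form `h`. So, up to a linear change of coordinates, the projected curve is given
by the forms `q * m_j` and `h`. Since `L` misses the curve, `h` does not vanish at the roots of `q`.

The splitting type is read off from the relations between the rows of the Jacobian matrix. By
Euler's identity the gradients of the `q * m_j` are combinations of the vectors `(∂_s m_j)_j` and
`(∂_t m_j)_j`, which are killed by the `d` second differences `t² p_r - 2 s t p_(r+1) + s² p_(r+2)`,
of degree 2. One more relation has degree 6: if `∑ g_j ∂_i m_j = q_i h - q h_i` for `i = s, t`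
(subscripts of `q`, `h` are derivatives), then Euler gives `∑ g_j m_j = -q h`, hence `q² ∂_i h + ∑
g_j ∂_i(q m_j) = 0`. Such sextics `g_j` exist by `hasSexticRelation_binaryForm`.

These relations make `𝒪(1)² ⟶ 𝒪(n)^(d+3) ⟶ 𝒪(n+2)^d ⊕ 𝒪(n+6) ⟶ 0` exact. The second differences are
surjective, with kernel spanned by the two derivative vectors (`secondDiffMatrix_surjective`,
`mem_span_monomDeriv`). On that kernel together with the last coordinate, the sextic row becomes
`(q_s h - q h_s, q_t h - q h_t, q²)`, which up to a unit is the vector of 2 × 2 minors of the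
Jacobian. The three forms have no common zero, because the roots of `q` are simple and are not roots
of `h`; Cramer's rule then gives `ker_relationMatrix` and a correction argument gives
`relationMatrix_surjective`.

For the rank, `normalMatrix` factors through `ℂ³`, with one coordinate for each of the three points,
as an injective map after a surjective one (`rank_normalMatrix`). -/

noncomputable section

/-! ## The exact sequence of second differences -/

section SecondDiff

variable {R : Type*} [CommRing R]

/-- The monomial `s ^ (d + 1 - j) * t ^ j` of degree `d + 1`. -/
def monom (d : ℕ) (s t : R) (j : Fin (d + 2)) : R := s ^ (d + 1 - (j : ℕ)) * t ^ (j : ℕ)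

/-- The derivative of `monom d s t j` with respect to `s`. -/
def monomDerivS (d : ℕ) (s t : R) (j : Fin (d + 2)) : R :=
  ((d + 1 - (j : ℕ) : ℕ) : R) * s ^ (d - (j : ℕ)) * t ^ (j : ℕ)

/-- The derivative of `monom d s t j` with respect to `t`. -/
def monomDerivT (d : ℕ) (s t : R) (j : Fin (d + 2)) : R :=
  ((j : ℕ) : R) * s ^ (d + 1 - (j : ℕ)) * t ^ ((j : ℕ) - 1)

/-- The matrix of the map `p ↦ (t² p_r - 2 s t p_(r+1) + s² p_(r+2))_r`. -/
def secondDiffMatrix (d : ℕ) (s t : R) : Matrix (Fin d) (Fin (d + 2)) R :=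
  Matrix.of fun r => Pi.single r.castSucc.castSucc (t ^ 2) +
    Pi.single r.castSucc.succ (-2 * s * t) + Pi.single r.succ.succ (s ^ 2)

lemma secondDiffMatrix_mulVec (d : ℕ) (s t : R) (p : Fin (d + 2) → R) (r : Fin d) :
    (secondDiffMatrix d s t).mulVec p r =
      t ^ 2 * p r.castSucc.castSucc - 2 * s * t * p r.castSucc.succ + s ^ 2 * p r.succ.succ := by
  change (Pi.single r.castSucc.castSucc (t ^ 2) + Pi.single r.castSucc.succ (-2 * s * t) +
    Pi.single r.succ.succ (s ^ 2)) ⬝ᵥ p = _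
  rw [add_dotProduct, add_dotProduct, single_dotProduct, single_dotProduct, single_dotProduct]
  ring

/-- Reversing indices exchanges `s` and `t`. This symmetry turns statements about powers of `s` into
statements about powers of `t`. -/
lemma monomDerivS_rev (d : ℕ) (s t : R) (j : Fin (d + 2)) :
    monomDerivS d s t j.rev = monomDerivT d t s j := by
  have := j.isLt
  rw [monomDerivS, monomDerivT, Fin.val_rev, mul_right_comm,
    show d + 1 - (d + 2 - ((j : ℕ) + 1)) = j by omega,
    show d - (d + 2 - ((j : ℕ) + 1)) = (j : ℕ) - 1 by omega,
    show d + 2 - ((j : ℕ) + 1) = d + 1 - j by omega]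

lemma monomDerivT_rev (d : ℕ) (s t : R) (j : Fin (d + 2)) :
    monomDerivT d s t j.rev = monomDerivS d t s j := by
  rw [← monomDerivS_rev, Fin.rev_rev]

/-- Euler's identity for the partial derivatives of monomials. -/
lemma euler_monom (d : ℕ) (s t : R) (j : Fin (d + 2)) :
    s * monomDerivS d s t j + t * monomDerivT d s t j = (d + 1) * monom d s t j := by
  obtain ⟨j, hj⟩ := j
  simp only [monom, monomDerivS, monomDerivT]
  have h1 : s * (((d + 1 - j : ℕ) : R) * s ^ (d - j) * t ^ j) =
      ((d + 1 - j : ℕ) : R) * s ^ (d + 1 - j) * t ^ j := by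
    rcases Nat.lt_or_ge d j with h | h
    · rw [show d + 1 - j = 0 by omega]; simp
    · rw [show d + 1 - j = d - j + 1 by omega]; ring
  have h2 : t * ((j : R) * s ^ (d + 1 - j) * t ^ (j - 1)) = (j : R) * s ^ (d + 1 - j) * t ^ j := by
    cases j with
    | zero => simp
    | succ j => simp only [Nat.add_sub_cancel]; ring
  rw [h1, h2, Nat.cast_sub (by omega)]
  push_cast
  ring

/-- A function satisfying the second order recursion is determined by its first two values. -/
lemma pow_mul_of_secondDiff {d : ℕ} {s t : R} {P : ℕ → R}
    (h : ∀ r < d, t ^ 2 * P r - 2 * s * t * P (r + 1) + s ^ 2 * P (r + 2) = 0) (j : ℕ) :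
    j ≤ d → s ^ (j + 1) * P (j + 1) = (j + 1) * t ^ j * (s * P 1) - j * t ^ (j + 1) * P 0 := by
  induction j using Nat.strong_induction_on with
  | _ j ih =>
    intro hj
    match j, ih, hj with
    | 0, _, _ => simp
    | 1, _, hj =>
      have := h 0 (by omega)
      simp only [zero_add] at this
      push_cast
      linear_combination this
    | j + 2, ih, hj =>
      have h0 := ih j (by omega) (by omega)
      have h1 := ih (j + 1) (by omega) (by omega)
      have h2 := h (j + 1) (by omega)
      push_cast at h0 h1 h2 ⊢
      linear_combination s ^ (j + 1) * h2 + 2 * t * h1 - t ^ 2 * h0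

/-- The recursion determines a kernel vector from its first two entries once powers of `s` may be
divided out; multiplying by `s ^ (d + 1)` pays for those divisions. -/
lemma pow_smul_mem_span_monomDeriv {d : ℕ} {s t D : R} (hD : (d + 1) * D = 1)
    {p : Fin (d + 2) → R} (hp : (secondDiffMatrix d s t).mulVec p = 0) :
    s ^ (d + 1) • p ∈ Submodule.span R {monomDerivS d s t, monomDerivT d s t} := by
  -- Extension by zero gives natural-number indices; the recursion for `r < d` only meets genuine
  -- entries.
  set P : ℕ → R := fun j => if h : j < d + 2 then p ⟨j, h⟩ else 0 with hP
  have hPp : ∀ j : Fin (d + 2), p j = P j := fun j => by simp [hP]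
  have hrec : ∀ r < d, t ^ 2 * P r - 2 * s * t * P (r + 1) + s ^ 2 * P (r + 2) = 0 := by
    intro r hr
    have := congrFun hp ⟨r, hr⟩
    rw [secondDiffMatrix_mulVec] at this
    simpa [hPp] using this
  rw [Submodule.mem_span_pair]
  -- The coefficients are forced by entries 0 and 1: `monomDerivT` vanishes at 0, and `D` inverts
  -- the factor `d + 1` of `monomDerivS` there.
  refine ⟨s * D * P 0, s * P 1 - d * D * t * P 0, ?_⟩
  ext j
  rw [Pi.add_apply, Pi.smul_apply, Pi.smul_apply, Pi.smul_apply, hPp]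
  obtain ⟨j, hj⟩ := j
  simp only [monomDerivS, monomDerivT, smul_eq_mul]
  cases j with
  | zero =>
    simp only [Nat.sub_zero, Nat.cast_zero, pow_zero]
    push_cast
    linear_combination s ^ (d + 1) * P 0 * hD
  | succ j =>
    have h := pow_mul_of_secondDiff hrec j (by omega)
    obtain ⟨c, rfl⟩ : ∃ c, d = j + c := ⟨d - j, by omega⟩
    simp only [Nat.add_sub_cancel, show j + c + 1 - (j + 1) = c by omega]
    cases c with
    | zero =>
      simp only [add_zero] at hD ⊢
      push_cast
      linear_combination (-1) * h - j * P 0 * t ^ (j + 1) * hD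
    | succ c =>
      rw [show j + (c + 1) - (j + 1) = c by omega]
      push_cast at hD ⊢
      linear_combination (-s ^ (c + 1)) * h - j * P 0 * t ^ (j + 1) * s ^ (c + 1) * hD

lemma span_pair_eq_top_of_isCoprime {s t : R} (h : IsCoprime s t) :
    Ideal.span {s, t} = ⊤ := by
  rw [Ideal.eq_top_iff_one, Ideal.mem_span_pair]
  exact h

lemma secondDiffMatrix_mulVec_rev {d : ℕ} {s t : R} (p : Fin (d + 2) → R) (r : Fin d) :
    (secondDiffMatrix d t s).mulVec (p ∘ Fin.rev) r = (secondDiffMatrix d s t).mulVec p r.rev := by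
  simp only [secondDiffMatrix_mulVec, Function.comp_apply, Fin.rev_castSucc, Fin.rev_succ]
  rw [Fin.succ_castSucc]
  ring

/-- The kernel of the second difference map is spanned by the derivatives of the monomials. -/
lemma mem_span_monomDeriv {d : ℕ} {s t D : R} (hst : IsCoprime s t) (hD : (d + 1) * D = 1)
    {p : Fin (d + 2) → R} (hp : (secondDiffMatrix d s t).mulVec p = 0) :
    p ∈ Submodule.span R {monomDerivS d s t, monomDerivT d s t} := by
  -- Membership is local: since `s` and `t` generate the unit ideal, a power of each may be used.
  -- The power of `t` comes from the reversal symmetry.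
  refine Submodule.mem_of_span_eq_top_of_smul_pow_mem _ _ (span_pair_eq_top_of_isCoprime hst) _ ?_
  rintro ⟨r, rfl | rfl⟩
  · exact ⟨d + 1, pow_smul_mem_span_monomDeriv hD hp⟩
  · refine ⟨d + 1, ?_⟩
    have h := pow_smul_mem_span_monomDeriv (s := r) (t := s) (p := p ∘ Fin.rev) hD
      (by ext i; rw [secondDiffMatrix_mulVec_rev, hp]; rfl)
    rw [Submodule.mem_span_pair] at h ⊢
    obtain ⟨a, b, hab⟩ := h
    refine ⟨b, a, ?_⟩
    ext j
    have := congrFun hab j.rev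
    simp only [Pi.add_apply, Pi.smul_apply, Function.comp_apply, Fin.rev_rev, monomDerivS_rev,
      monomDerivT_rev] at this
    rw [Pi.add_apply, Pi.smul_apply, Pi.smul_apply, Pi.smul_apply, add_comm]
    exact this

/-- Column `k` of the matrix is `t² e_k - 2 s t e_(k-1) + s² e_(k-2)`. Multiplying it by `t ^ k` and
removing the two lower terms by induction leaves `t ^ (k + 2) e_k`. -/
lemma pow_smul_single_mem_range (d : ℕ) (s t : R) (k : ℕ) (hk : k < d) :
    t ^ (k + 2) • (Pi.single ⟨k, hk⟩ 1 : Fin d → R) ∈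
      LinearMap.range (secondDiffMatrix d s t).mulVecLin := by
  set N := LinearMap.range (secondDiffMatrix d s t).mulVecLin
  set f : ℕ → Fin d → R := fun k => if h : k < d then Pi.single ⟨k, h⟩ 1 else 0 with hf
  have hcol : ∀ k, k < d + 2 → t ^ 2 • f k - (if 1 ≤ k then (2 * s * t) • f (k - 1) else 0) +
      (if 2 ≤ k then s ^ 2 • f (k - 2) else 0) ∈ N := by
    intro k hk
    refine ⟨Pi.single ⟨k, hk⟩ 1, ?_⟩
    ext r
    rw [Matrix.mulVecLin_apply, secondDiffMatrix_mulVec]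
    obtain ⟨r, hr⟩ := r
    have e : ∀ i, (f i) ⟨r, hr⟩ = if r = i then 1 else 0 := by
      intro i
      simp only [hf]
      split_ifs with h1 h2 h2
      · subst h2; simp
      · rw [Pi.single_apply, if_neg (by simpa using h2)]
      · omega
      · rfl
    have e' : ∀ (P : Prop) [Decidable P] (v : Fin d → R), (if P then v else 0) ⟨r, hr⟩ =
        if P then v ⟨r, hr⟩ else 0 := by
      intro P _ v; split_ifs <;> rfl
    simp only [Pi.add_apply, Pi.sub_apply, e', Pi.smul_apply, e, Pi.single_apply, Fin.ext_iff,
      Fin.val_succ, Fin.val_castSucc, smul_eq_mul]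
    congr 1
    · congr 1
      split_ifs <;> first | rfl | omega | simp
    · split_ifs <;> first | rfl | omega | simp
  have hfk : f k = Pi.single ⟨k, hk⟩ 1 := by simp [hf, hk]
  rw [← hfk]
  clear hfk
  induction k using Nat.strong_induction_on with
  | _ k ih =>
    match k, hk, ih with
    | 0, hk, _ => simpa using hcol 0 (by omega)
    | 1, hk, ih =>
      have h0 := ih 0 (by omega) (by omega)
      have h1 := hcol 1 (by omega)
      simp only [le_refl, if_true, Nat.sub_self, Nat.not_ofNat_le_one, if_false, add_zero] at h1
      have := N.add_mem (N.smul_mem t h1) (N.smul_mem (2 * s) h0)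
      convert this using 1
      module
    | k + 2, hk, ih =>
      have h0 := ih k (by omega) (by omega)
      have h1 := ih (k + 1) (by omega) (by omega)
      have h2 := hcol (k + 2) (by omega)
      rw [if_pos (by omega), if_pos (by omega)] at h2
      simp only [Nat.add_sub_cancel, show k + 2 - 1 = k + 1 by omega] at h2
      have := N.add_mem (N.add_mem (N.smul_mem (t ^ (k + 2)) h2) (N.smul_mem (2 * s) h1))
        (N.smul_mem (-s ^ 2) h0)
      convert this using 1
      module

/-- Each basis vector lies in the range after multiplication by a power of `t` and, by reversal, by
a power of `s`; coprimality removes the powers. -/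
lemma secondDiffMatrix_surjective {d : ℕ} {s t : R} (hst : IsCoprime s t) :
    Function.Surjective (secondDiffMatrix d s t).mulVec := by
  have key : ∀ r : Fin d, (Pi.single r 1 : Fin d → R) ∈
      LinearMap.range (secondDiffMatrix d s t).mulVecLin := by
    intro r
    refine Submodule.mem_of_span_eq_top_of_smul_pow_mem _ _
      (span_pair_eq_top_of_isCoprime hst) _ ?_
    rintro ⟨x, rfl | rfl⟩
    · obtain ⟨p, hp⟩ := pow_smul_single_mem_range d t x _ r.rev.isLt
      refine ⟨(r.rev : ℕ) + 2, p ∘ Fin.rev, ?_⟩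
      ext i
      rw [Matrix.mulVecLin_apply, secondDiffMatrix_mulVec_rev]
      refine (congrFun hp i.rev).trans ?_
      change (x ^ _ • (Pi.single r.rev 1 : Fin d → R)) i.rev = (x ^ _ • Pi.single r 1 : Fin d → R) i
      rw [Pi.smul_apply, Pi.smul_apply, Pi.single_apply, Pi.single_apply]
      simp only [Fin.rev_inj]
    · exact ⟨r + 2, pow_smul_single_mem_range d s x r r.isLt⟩
  have htop : LinearMap.range (secondDiffMatrix d s t).mulVecLin = ⊤ := by
    rw [eq_top_iff]
    intro y _
    rw [pi_eq_sum_univ' y]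
    exact Submodule.sum_mem _ fun i _ => Submodule.smul_mem _ _ (key i)
  exact LinearMap.range_eq_top.mp htop

end SecondDiff

/-! ### Exactness of the Jacobian and relation matrices over a ring -/

section Exactness

variable {R : Type*} [CommRing R]

/-- The second difference is the operator `(t - s * shift)²`, and the entries are linear in the
index times a geometric progression of ratio `t / s`. -/
lemma secondDiffMatrix_mulVec_monomDerivS (d : ℕ) (s t : R) :
    (secondDiffMatrix d s t).mulVec (monomDerivS d s t) = 0 := by
  ext ⟨r, hr⟩
  rw [secondDiffMatrix_mulVec]
  simp only [monomDerivS, Fin.val_succ, Fin.val_castSucc, Pi.zero_apply]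
  obtain ⟨c, rfl⟩ : ∃ c, d = r + 1 + c := ⟨d - (r + 1), by omega⟩
  -- In the last row the exponent `d - (d + 1)` is truncated to 0; its coefficient is 0, so this row
  -- is checked separately.
  cases c with
  | zero =>
    simp only [add_zero, show r + 1 + 1 - r = 2 by omega, show r + 1 - r = 1 by omega,
      Nat.add_sub_cancel_left, Nat.sub_self]
    push_cast
    ring
  | succ c =>
    rw [show r + 1 + (c + 1) + 1 - r = c + 3 by omega, show r + 1 + (c + 1) - r = c + 2 by omega,
      show r + 1 + (c + 1) + 1 - (r + 1) = c + 2 by omega,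
      show r + 1 + (c + 1) - (r + 1) = c + 1 by omega,
      show r + 1 + (c + 1) + 1 - (r + 1 + 1) = c + 1 by omega,
      show r + 1 + (c + 1) - (r + 1 + 1) = c by omega]
    push_cast
    ring

lemma secondDiffMatrix_mulVec_monomDerivT (d : ℕ) (s t : R) :
    (secondDiffMatrix d s t).mulVec (monomDerivT d s t) = 0 := by
  have h : monomDerivT d s t = monomDerivS d t s ∘ Fin.rev := by
    ext j; exact (monomDerivS_rev d t s j).symm
  ext r
  rw [h, secondDiffMatrix_mulVec_rev, secondDiffMatrix_mulVec_monomDerivS]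
  rfl

/-- The Jacobian matrix of the forms `q * monom d s t j` and `h`, in terms of the partial
derivatives of `q` and `h`. -/
def adaptedJacobian (d : ℕ) (s t q qs qt hs ht : R) : Matrix (Fin (d + 2) ⊕ Fin 1) (Fin 2) R :=
  Matrix.of fun k i => Sum.elim
    (fun j => ![qs, qt] i * monom d s t j + q * ![monomDerivS d s t j, monomDerivT d s t j] i)
    (fun _ => ![hs, ht] i) k

/-- The matrix of relations between the rows of the Jacobian matrix: second differences, and one
further row `(g, q²)`. -/
def relationMatrix (d : ℕ) (s t q : R) (g : Fin (d + 2) → R) :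
    Matrix (Fin d ⊕ Fin 1) (Fin (d + 2) ⊕ Fin 1) R :=
  Matrix.fromBlocks (secondDiffMatrix d s t) 0 (Matrix.of fun _ j => g j)
    (Matrix.of fun _ _ => q ^ 2)

lemma relationMatrix_mulVec_inl (d : ℕ) (s t q : R) (g : Fin (d + 2) → R)
    (p : Fin (d + 2) ⊕ Fin 1 → R) (r : Fin d) :
    (relationMatrix d s t q g).mulVec p (Sum.inl r) =
      (secondDiffMatrix d s t).mulVec (p ∘ Sum.inl) r := by
  rw [relationMatrix, Matrix.fromBlocks_mulVec]
  simp

lemma relationMatrix_mulVec_inr (d : ℕ) (s t q : R) (g : Fin (d + 2) → R)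
    (p : Fin (d + 2) ⊕ Fin 1 → R) (r : Fin 1) :
    (relationMatrix d s t q g).mulVec p (Sum.inr r) =
      ∑ j, g j * p (Sum.inl j) + q ^ 2 * p (Sum.inr 0) := by
  rw [relationMatrix, Matrix.fromBlocks_mulVec]
  simp [Matrix.mulVec, dotProduct]

lemma adaptedJacobian_mulVec_inl (d : ℕ) (s t q qs qt hs ht : R) (w : Fin 2 → R)
    (j : Fin (d + 2)) :
    (adaptedJacobian d s t q qs qt hs ht).mulVec w (Sum.inl j) =
      (qs * monom d s t j + q * monomDerivS d s t j) * w 0 +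
      (qt * monom d s t j + q * monomDerivT d s t j) * w 1 := by
  simp [adaptedJacobian, Matrix.mulVec, dotProduct, Fin.sum_univ_two]

lemma adaptedJacobian_mulVec_inr (d : ℕ) (s t q qs qt hs ht : R) (w : Fin 2 → R) (r : Fin 1) :
    (adaptedJacobian d s t q qs qt hs ht).mulVec w (Sum.inr r) = hs * w 0 + ht * w 1 := by
  simp [adaptedJacobian, Matrix.mulVec, dotProduct, Fin.sum_univ_two]

/-- The value of the last row of the relation matrix on a vector whose second differences
vanish. -/
lemma sum_mul_comb_monomDeriv {d : ℕ} {s t q h qs qt hs ht : R} {g : Fin (d + 2) → R}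
    (hgS : ∑ j, g j * monomDerivS d s t j = qs * h - q * hs)
    (hgT : ∑ j, g j * monomDerivT d s t j = qt * h - q * ht) (a b : R) :
    ∑ j, g j * (a * monomDerivS d s t j + b * monomDerivT d s t j) =
      a * (qs * h - q * hs) + b * (qt * h - q * ht) := by
  rw [← hgS, ← hgT, Finset.mul_sum, Finset.mul_sum, ← Finset.sum_add_distrib]
  exact Finset.sum_congr rfl fun j _ => by ring

lemma secondDiffMatrix_mulVec_comb (d : ℕ) (s t a b : R) :
    (secondDiffMatrix d s t).mulVec
      (fun j => a * monomDerivS d s t j + b * monomDerivT d s t j) = 0 := by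
  have : (fun j => a * monomDerivS d s t j + b * monomDerivT d s t j) =
      a • monomDerivS d s t + b • monomDerivT d s t := rfl
  rw [this, Matrix.mulVec_add, Matrix.mulVec_smul, Matrix.mulVec_smul,
    secondDiffMatrix_mulVec_monomDerivS, secondDiffMatrix_mulVec_monomDerivT]
  simp

/-- Euler's identity eliminates `monom`, so the upper rows of the Jacobian factor through a 2 × 2
matrix acting on the coordinates along the two derivative vectors. -/
lemma adaptedJacobian_entry {d : ℕ} {s t D : R} (hD : (d + 1) * D = 1) (q qs qt u v : R)
    (j : Fin (d + 2)) :
    (qs * monom d s t j + q * monomDerivS d s t j) * u +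
      (qt * monom d s t j + q * monomDerivT d s t j) * v =
    ((qs * s * D + q) * u + qt * s * D * v) * monomDerivS d s t j +
      (qs * t * D * u + (qt * t * D + q) * v) * monomDerivT d s t j := by
  linear_combination (-(qs * u + qt * v) * D) * euler_monom d s t j -
    (qs * u + qt * v) * monom d s t j * hD

/-- After lifting the second differences, only the last entry is wrong. It is corrected by a kernel
vector of the second differences, on which the last row takes the value 1 by `hc`. -/
theorem relationMatrix_surjective {d : ℕ} {s t q h qs qt hs ht : R} {g : Fin (d + 2) → R}
    (hst : IsCoprime s t)
    (hgS : ∑ j, g j * monomDerivS d s t j = qs * h - q * hs)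
    (hgT : ∑ j, g j * monomDerivT d s t j = qt * h - q * ht) {c : Fin 3 → R}
    (hc : c 0 * (qs * h - q * hs) + c 1 * (qt * h - q * ht) + c 2 * q ^ 2 = 1) :
    Function.Surjective (relationMatrix d s t q g).mulVec := by
  intro y
  obtain ⟨p, hp⟩ := secondDiffMatrix_surjective hst (y ∘ Sum.inl)
  set z := y (Sum.inr 0) - ∑ j, g j * p j with hz
  refine ⟨Sum.elim (p + fun j => z * c 0 * monomDerivS d s t j + z * c 1 * monomDerivT d s t j)
    (fun _ => z * c 2), ?_⟩
  ext (r | r)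
  · rw [relationMatrix_mulVec_inl, Sum.elim_comp_inl, Matrix.mulVec_add,
      secondDiffMatrix_mulVec_comb, hp]
    simp
  · rw [relationMatrix_mulVec_inr, Subsingleton.elim r 0]
    simp only [Sum.elim_inl, Sum.elim_inr, Pi.add_apply, mul_add (g _), Finset.sum_add_distrib]
    have := sum_mul_comb_monomDeriv hgS hgT (z * c 0) (z * c 1)
    simp only [mul_add (g _), Finset.sum_add_distrib] at this
    linear_combination this + z * hc + hz

/-- In the coordinates `(a, b, e)` on the kernel of the second differences the Jacobian is a 3 × 2
matrix, and the last relation is, up to the unit `(d + 4) * D`, its vector of minors. As the minors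
generate the unit ideal, a vector killed by them is in the image. -/
theorem ker_relationMatrix {d : ℕ} {s t q h qs qt hs ht D E : R} {g : Fin (d + 2) → R}
    (hst : IsCoprime s t) (hD : (d + 1) * D = 1) (hE : (d + 4) * E = 1)
    (hq : s * qs + t * qt = 3 * q) (hh : s * hs + t * ht = (d + 4) * h)
    (hgS : ∑ j, g j * monomDerivS d s t j = qs * h - q * hs)
    (hgT : ∑ j, g j * monomDerivT d s t j = qt * h - q * ht) {c : Fin 3 → R}
    (hc : c 0 * (qs * h - q * hs) + c 1 * (qt * h - q * ht) + c 2 * q ^ 2 = 1) :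
    LinearMap.ker (relationMatrix d s t q g).mulVecLin =
      LinearMap.range (adaptedJacobian d s t q qs qt hs ht).mulVecLin := by
  have hDD : 1 + 3 * D = (d + 4) * D := by linear_combination -hD
  -- the 2 × 2 minors of the Hilbert–Burch matrix
  have m0 : qs * t * D * ht - hs * (qt * t * D + q) = (d + 4) * D * (qs * h - q * hs) := by
    linear_combination D * qs * hh - D * hs * hq - q * hs * hDD
  have m1 : hs * (qt * s * D) - (qs * s * D + q) * ht = (d + 4) * D * (qt * h - q * ht) := by
    linear_combination D * qt * hh - D * ht * hq - q * ht * hDD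
  have m2 : (qs * s * D + q) * (qt * t * D + q) - qs * t * D * (qt * s * D) =
      (d + 4) * D * q ^ 2 := by
    linear_combination q * D * hq + q ^ 2 * hDD
  apply le_antisymm
  · intro p hp
    rw [LinearMap.mem_ker, Matrix.mulVecLin_apply] at hp
    have h1 : (secondDiffMatrix d s t).mulVec (p ∘ Sum.inl) = 0 := by
      ext r
      rw [← relationMatrix_mulVec_inl d s t q g, hp]; rfl
    obtain ⟨a, b, hab⟩ := Submodule.mem_span_pair.mp (mem_span_monomDeriv hst hD h1)
    have hpj : ∀ j, p (Sum.inl j) = a * monomDerivS d s t j + b * monomDerivT d s t j :=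
      fun j => (congrFun hab j).symm
    have h2 := congrFun hp (Sum.inr 0)
    rw [relationMatrix_mulVec_inr] at h2
    simp only [hpj] at h2
    rw [sum_mul_comb_monomDeriv hgS hgT, Pi.zero_apply] at h2
    set e := p (Sum.inr 0) with he
    -- Cramer's rule
    have hmu : ((d : R) + 4) * D * ((d + 1) * E) = 1 := by
      linear_combination hE + (d + 4) * E * hD
    set u := (d + 1) * E * (c 0 * (b * ht - e * (qt * t * D + q)) +
      c 1 * (e * (qt * s * D) - a * ht) + c 2 * (a * (qt * t * D + q) - b * (qt * s * D))) with hu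
    set v := (d + 1) * E * (c 0 * (qs * t * D * e - hs * b) +
      c 1 * (hs * a - (qs * s * D + q) * e) + c 2 * ((qs * s * D + q) * b - qs * t * D * a)) with hv
    -- The 3 × 2 matrix augmented by `(a, b, e)` is singular: this is the solvability condition. The
    -- weights `c` then combine the three Cramer solutions into one valid without dividing by a
    -- single minor.
    have hdet : a * (qs * t * D * ht - hs * (qt * t * D + q)) +
        b * (hs * (qt * s * D) - (qs * s * D + q) * ht) +
        e * ((qs * s * D + q) * (qt * t * D + q) - qs * t * D * (qt * s * D)) = 0 := by
      linear_combination a * m0 + b * m1 + e * m2 + (d + 4) * D * h2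
    have hone : (d + 1) * E * (c 0 * (qs * t * D * ht - hs * (qt * t * D + q)) +
        c 1 * (hs * (qt * s * D) - (qs * s * D + q) * ht) +
        c 2 * ((qs * s * D + q) * (qt * t * D + q) - qs * t * D * (qt * s * D))) = 1 := by
      linear_combination (d + 1) * E * (c 0 * m0 + c 1 * m1 + c 2 * m2) +
        hc * ((d + 4) * D * ((d + 1) * E)) + hmu
    have ea : (qs * s * D + q) * u + qt * s * D * v = a := by
      linear_combination a * hone + (qs * s * D + q) * hu + qt * s * D * hv -
        (d + 1) * E * c 0 * hdet
    have eb : qs * t * D * u + (qt * t * D + q) * v = b := by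
      linear_combination b * hone + qs * t * D * hu + (qt * t * D + q) * hv -
        (d + 1) * E * c 1 * hdet
    have ee : hs * u + ht * v = e := by
      linear_combination e * hone + hs * hu + ht * hv - (d + 1) * E * c 2 * hdet
    refine ⟨![u, v], ?_⟩
    ext (j | j)
    · rw [Matrix.mulVecLin_apply, adaptedJacobian_mulVec_inl, hpj, adaptedJacobian_entry hD]
      simp only [Matrix.cons_val_zero, Matrix.cons_val_one]
      rw [ea, eb]
    · rw [Matrix.mulVecLin_apply, adaptedJacobian_mulVec_inr, Subsingleton.elim j 0]
      exact ee
  · rintro _ ⟨w, rfl⟩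
    rw [LinearMap.mem_ker, Matrix.mulVecLin_apply, Matrix.mulVecLin_apply]
    have hj : ∀ j, (adaptedJacobian d s t q qs qt hs ht).mulVec w (Sum.inl j) =
        ((qs * s * D + q) * w 0 + qt * s * D * w 1) * monomDerivS d s t j +
        (qs * t * D * w 0 + (qt * t * D + q) * w 1) * monomDerivT d s t j := fun j => by
      rw [adaptedJacobian_mulVec_inl, adaptedJacobian_entry hD]
    ext (r | r)
    · rw [relationMatrix_mulVec_inl, show _ ∘ Sum.inl = _ from funext hj,
        secondDiffMatrix_mulVec_comb]
      rfl
    · rw [relationMatrix_mulVec_inr]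
      simp only [hj]
      rw [sum_mul_comb_monomDeriv hgS hgT, adaptedJacobian_mulVec_inr]
      have hmu : ((d : R) + 4) * D * ((d + 1) * E) = 1 := by
        linear_combination hE + (d + 4) * E * hD
      set x := (qs * s * D + q) * w 0 + qt * s * D * w 1 with hx
      set y := qs * t * D * w 0 + (qt * t * D + q) * w 1 with hy
      rw [Pi.zero_apply]
      linear_combination (d + 1) * E * (-x * m0 - y * m1 - (hs * w 0 + ht * w 1) * m2 +
          hx * (qs * t * D * ht - hs * (qt * t * D + q)) +
          hy * (hs * (qt * s * D) - (qs * s * D + q) * ht)) -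
        (x * (qs * h - q * hs) + y * (qt * h - q * ht) + q ^ 2 * (hs * w 0 + ht * w 1)) * hmu

end Exactness

/-! ## Cokernels and exact sequences of sheaves -/

namespace SheafP1

/-- If `E ⟶ F ⟶ H ⟶ 0` is exact, then `H` is isomorphic to the cokernel of `E ⟶ F`. -/
lemma nonempty_iso_coker {E F H : SheafP1} (f : Hom E F) (g : Hom F H)
    (kA : LinearMap.ker g.mapA = LinearMap.range f.mapA)
    (kB : LinearMap.ker g.mapB = LinearMap.range f.mapB)
    (kC : LinearMap.ker g.mapC = LinearMap.range f.mapC)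
    (sA : Function.Surjective g.mapA) (sB : Function.Surjective g.mapB)
    (sC : Function.Surjective g.mapC) : Nonempty (Iso (coker f) H) :=
  ⟨{ equivA := (Submodule.quotEquivOfEq _ _ kA.symm).trans (g.mapA.quotKerEquivOfSurjective sA)
     equivB := (Submodule.quotEquivOfEq _ _ kB.symm).trans (g.mapB.quotKerEquivOfSurjective sB)
     equivC := (Submodule.quotEquivOfEq _ _ kC.symm).trans (g.mapC.quotKerEquivOfSurjective sC)
     commA := by
      intro a
      obtain ⟨a, rfl⟩ := Submodule.mkQ_surjective _ a
      exact g.commA a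
     commB := by
      intro b
      obtain ⟨b, rfl⟩ := Submodule.mkQ_surjective _ b
      exact g.commB b }⟩

/-- The morphism `𝒪(a) ^ ι ⟶ ⨁ j, 𝒪(b j)` given by a matrix of forms whose row `j` has
degree `e j = b j - a`. -/
def Hom.ofRowForms {ι κ : Type} [Fintype ι] [Fintype κ] (a : ℤ) (b : κ → ℤ) (e : κ → ℕ)
    (hab : ∀ j, b j = a + e j) (G : Matrix κ ι (MvPolynomial (Fin 2) ℂ))
    (hG : ∀ j i, (G j i).IsHomogeneous (e j)) :
    Hom (lineBundleSum fun _ : ι => a) (lineBundleSum b) where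
  mapA := Matrix.mulVecLin (G.map chartZero)
  mapB := Matrix.mulVecLin (G.map chartOne)
  mapC := Matrix.mulVecLin (G.map fun g => Polynomial.toLaurent (chartZero g))
  commA := by
    intro p
    refine funext fun j => ?_
    change Polynomial.toLaurent (Matrix.mulVec (G.map chartZero) p j) =
      Matrix.mulVec (G.map fun g => Polynomial.toLaurent (chartZero g))
        (fun i => Polynomial.toLaurent (p i)) j
    simp [Matrix.mulVec, dotProduct]
  commB := by
    intro q
    refine funext fun j => ?_
    change LaurentPolynomial.T (b j) * restrictOne (Matrix.mulVec (G.map chartOne) q j) =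
      Matrix.mulVec (G.map fun g => Polynomial.toLaurent (chartZero g))
        (fun i => LaurentPolynomial.T a * restrictOne (q i)) j
    simp only [Matrix.mulVec, dotProduct, Matrix.map_apply, map_sum, map_mul, Finset.mul_sum]
    refine Finset.sum_congr rfl fun i _ => ?_
    rw [chart_compat _ (e j) (hG j i), hab j, LaurentPolynomial.T_add]
    ring

/-- A splitting criterion: the cokernel of a matrix of forms `J` has splitting type `b` if there is
a matrix `G` of forms of the right degrees such that `J, G` becomes a right exact sequence in every
commutative algebra in which the two coordinates are coprime. -/
lemma hasSplittingType_coker_ofForms {ι κ μ : Type} [Fintype ι] [Fintype κ] [Fintype μ]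
    (a₀ a : ℤ) (e₀ : ℕ) (ha : a = a₀ + e₀) (b : μ → ℤ) (e : μ → ℕ) (hb : ∀ j, b j = a + e j)
    (J : Matrix κ ι (MvPolynomial (Fin 2) ℂ)) (hJ : ∀ j i, (J j i).IsHomogeneous e₀)
    (G : Matrix μ κ (MvPolynomial (Fin 2) ℂ)) (hG : ∀ j i, (G j i).IsHomogeneous (e j))
    (hker : ∀ (R : Type) [CommRing R] [Algebra ℂ R] (φ : MvPolynomial (Fin 2) ℂ →ₐ[ℂ] R),
      IsCoprime (φ (.X 0)) (φ (.X 1)) →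
        LinearMap.ker (G.map φ).mulVecLin = LinearMap.range (J.map φ).mulVecLin)
    (hsurj : ∀ (R : Type) [CommRing R] [Algebra ℂ R] (φ : MvPolynomial (Fin 2) ℂ →ₐ[ℂ] R),
      IsCoprime (φ (.X 0)) (φ (.X 1)) → Function.Surjective (G.map φ).mulVec) :
    (coker (Hom.ofForms a₀ a e₀ ha J hJ)).HasSplittingType b := by
  -- The three section modules correspond to the coordinate pairs `(1, x)`, `(y, 1)`, and `(1, x)`
  -- over Laurent polynomials; one entry is 1 each time.
  have c0 : IsCoprime (MvPolynomial.aeval (R := ℂ) ![1, (Polynomial.X : ℂ[X])] (.X 0))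
      (MvPolynomial.aeval (R := ℂ) ![1, (Polynomial.X : ℂ[X])] (.X 1)) := by
    simp [isCoprime_one_left]
  have c1 : IsCoprime (MvPolynomial.aeval (R := ℂ) ![(Polynomial.X : ℂ[X]), 1] (.X 0))
      (MvPolynomial.aeval (R := ℂ) ![(Polynomial.X : ℂ[X]), 1] (.X 1)) := by
    simp [isCoprime_one_right]
  have c2 := c0.map (Polynomial.toLaurentAlg (R := ℂ) : ℂ[X] →+* ℂ[T;T⁻¹])
  exact nonempty_iso_coker _ (Hom.ofRowForms a b e hb G hG)
    (hker ℂ[X] (MvPolynomial.aeval ![1, Polynomial.X]) c0)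
    (hker ℂ[X] (MvPolynomial.aeval ![Polynomial.X, 1]) c1)
    (hker ℂ[T;T⁻¹] (Polynomial.toLaurentAlg.comp (MvPolynomial.aeval ![1, Polynomial.X])) c2)
    (hsurj ℂ[X] (MvPolynomial.aeval ![1, Polynomial.X]) c0)
    (hsurj ℂ[X] (MvPolynomial.aeval ![Polynomial.X, 1]) c1)
    (hsurj ℂ[T;T⁻¹] (Polynomial.toLaurentAlg.comp (MvPolynomial.aeval ![1, Polynomial.X])) c2)

end SheafP1

/-! ## Relations between the partial derivatives -/

section Relations

open MvPolynomial

lemma map_monom {R S : Type*} [CommRing R] [CommRing S] (φ : R →+* S) (d : ℕ) (s t : R)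
    (j : Fin (d + 2)) : φ (monom d s t j) = monom d (φ s) (φ t) j := by
  simp [monom]

lemma map_monomDerivS {R S : Type*} [CommRing R] [CommRing S] (φ : R →+* S) (d : ℕ) (s t : R)
    (j : Fin (d + 2)) : φ (monomDerivS d s t j) = monomDerivS d (φ s) (φ t) j := by
  simp [monomDerivS]

lemma map_monomDerivT {R S : Type*} [CommRing R] [CommRing S] (φ : R →+* S) (d : ℕ) (s t : R)
    (j : Fin (d + 2)) : φ (monomDerivT d s t j) = monomDerivT d (φ s) (φ t) j := by
  simp [monomDerivT]

lemma pderiv_zero_monom (d : ℕ) (j : Fin (d + 2)) :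
    pderiv (R := ℂ) (0 : Fin 2) (monom d (X 0) (X 1) j) = monomDerivS d (X 0) (X 1) j := by
  rw [monom, monomDerivS, pderiv_mul, pderiv_pow, pderiv_pow, pderiv_X_self,
    pderiv_X_of_ne (by decide), show d + 1 - (j : ℕ) - 1 = d - j by omega]
  simp

lemma pderiv_one_monom (d : ℕ) (j : Fin (d + 2)) :
    pderiv (R := ℂ) (1 : Fin 2) (monom d (X 0) (X 1) j) = monomDerivT d (X 0) (X 1) j := by
  rw [monom, monomDerivT, pderiv_mul, pderiv_pow, pderiv_pow, pderiv_X_self,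
    pderiv_X_of_ne (by decide)]
  simp only [mul_zero, zero_mul, zero_add, mul_one]
  ring

lemma isHomogeneous_X_pow_mul (a b : ℕ) :
    ((X 0 : MvPolynomial (Fin 2) ℂ) ^ a * X 1 ^ b).IsHomogeneous (a + b) :=
  (isHomogeneous_X_pow 0 a).mul (isHomogeneous_X_pow 1 b)

lemma isHomogeneous_monom (d : ℕ) (j : Fin (d + 2)) :
    (monom d (X 0 : MvPolynomial (Fin 2) ℂ) (X 1) j).IsHomogeneous (d + 1) := by
  have h := isHomogeneous_X_pow_mul (d + 1 - j) j
  rwa [show d + 1 - (j : ℕ) + j = d + 1 by omega] at h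

/-- Euler's identity for binary forms. -/
lemma euler_two {f : MvPolynomial (Fin 2) ℂ} {n : ℕ} (hf : f.IsHomogeneous n) :
    X 0 * pderiv 0 f + X 1 * pderiv 1 f = (n : MvPolynomial (Fin 2) ℂ) * f := by
  have := hf.sum_X_mul_pderiv
  simpa [Fin.sum_univ_two] using this

section

variable {R : Type*} [CommRing R] (d : ℕ) (s t : R) (j : Fin (d + 1))

/-- Since `m_(j+1) = (t / s) m_j`, the combination `s t ∂m_j - s² ∂m_(j+1)` equals `-s² m_j ∂(t /
s)`, that is `(t, -s) m_j`. This is the shape in which the Wronskian enters `exists_wronskian`. -/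
lemma monomDerivS_castSucc_sub_succ :
    s * t * monomDerivS d s t j.castSucc - s ^ 2 * monomDerivS d s t j.succ =
      t * monom d s t j.castSucc := by
  obtain ⟨j, hj⟩ := j
  simp only [monomDerivS, monom, Fin.val_succ, Fin.val_castSucc]
  obtain ⟨c, rfl⟩ : ∃ c, d = j + c := ⟨d - j, by omega⟩
  cases c with
  | zero => simp; ring
  | succ c =>
    rw [show j + (c + 1) + 1 - j = c + 2 by omega, show j + (c + 1) - j = c + 1 by omega,
      show j + (c + 1) + 1 - (j + 1) = c + 1 by omega, show j + (c + 1) - (j + 1) = c by omega]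
    push_cast
    ring

lemma monomDerivT_castSucc_sub_succ :
    s * t * monomDerivT d s t j.castSucc - s ^ 2 * monomDerivT d s t j.succ =
      -s * monom d s t j.castSucc := by
  obtain ⟨j, hj⟩ := j
  simp only [monomDerivT, monom, Fin.val_succ, Fin.val_castSucc]
  obtain ⟨c, rfl⟩ : ∃ c, d = j + c := ⟨d - j, by omega⟩
  rw [show j + c + 1 - j = c + 1 by omega, show j + c + 1 - (j + 1) = c by omega]
  cases j with
  | zero => simp; ring
  | succ j => simp only [Nat.add_sub_cancel]; push_cast; ring

lemma mul_monom_succ : s * monom d s t j.succ = t * monom d s t j.castSucc := by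
  obtain ⟨j, hj⟩ := j
  simp only [monom, Fin.val_succ, Fin.val_castSucc]
  rw [show d + 1 - j = d + 1 - (j + 1) + 1 by omega]
  ring

end

/-- `h` admits a relation `q² ∂h + ∑ g_j ∂(q m_j) = 0` with forms `g_j` of degree six. -/
def HasSexticRelation (d : ℕ) (q h : MvPolynomial (Fin 2) ℂ) : Prop :=
  ∃ g : Fin (d + 2) → MvPolynomial (Fin 2) ℂ, (∀ j, (g j).IsHomogeneous 6) ∧
    ∑ j, g j * monomDerivS d (X 0) (X 1) j = pderiv 0 q * h - q * pderiv 0 h ∧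
    ∑ j, g j * monomDerivT d (X 0) (X 1) j = pderiv 1 q * h - q * pderiv 1 h

namespace HasSexticRelation

variable {d : ℕ} {q : MvPolynomial (Fin 2) ℂ}

lemma zero : HasSexticRelation d q 0 :=
  ⟨0, fun _ => isHomogeneous_zero _ _ _, by simp, by simp⟩

lemma add {h h' : MvPolynomial (Fin 2) ℂ} (H : HasSexticRelation d q h)
    (H' : HasSexticRelation d q h') : HasSexticRelation d q (h + h') := by
  obtain ⟨g, hg, hS, hT⟩ := H
  obtain ⟨g', hg', hS', hT'⟩ := H'
  refine ⟨g + g', fun j => (hg j).add (hg' j), ?_, ?_⟩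
  · simp only [Pi.add_apply, add_mul, Finset.sum_add_distrib, hS, hS', map_add]
    ring
  · simp only [Pi.add_apply, add_mul, Finset.sum_add_distrib, hT, hT', map_add]
    ring

lemma const_mul {h : MvPolynomial (Fin 2) ℂ} (c : ℂ) (H : HasSexticRelation d q h) :
    HasSexticRelation d q (C c * h) := by
  obtain ⟨g, hg, hS, hT⟩ := H
  refine ⟨fun j => C c * g j, fun j => ?_, ?_, ?_⟩
  · have := (isHomogeneous_C (Fin 2) c).mul (hg j)
    rwa [zero_add] at this
  · simp only [mul_assoc, ← Finset.mul_sum, hS, pderiv_C_mul]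
    ring
  · simp only [mul_assoc, ← Finset.mul_sum, hT, pderiv_C_mul]
    ring

/-- The Wronskian of two binary cubics, up to a factor. -/
lemma exists_wronskian (hq : q.IsHomogeneous 3) {c : MvPolynomial (Fin 2) ℂ}
    (hc : c.IsHomogeneous 3) : ∃ w : MvPolynomial (Fin 2) ℂ, w.IsHomogeneous 4 ∧
      X 1 * w = pderiv 0 q * c - q * pderiv 0 c ∧ -X 0 * w = pderiv 1 q * c - q * pderiv 1 c := by
  have h3 : (C (1 / 3 : ℂ) : MvPolynomial (Fin 2) ℂ) * 3 = 1 := by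
    rw [show (3 : MvPolynomial (Fin 2) ℂ) = C 3 from rfl, ← C_mul, ← C_1]
    norm_num
  have eq := euler_two hq
  have ec := euler_two hc
  push_cast at eq ec
  -- The factor `1 / 3` cancels the degree 3 in Euler's identity for the two cubics.
  refine ⟨C (1 / 3) * (pderiv 0 q * pderiv 1 c - pderiv 0 c * pderiv 1 q), ?_, ?_, ?_⟩
  · have := (isHomogeneous_C (Fin 2) (1 / 3 : ℂ)).mul
      ((hq.pderiv (i := 0)).mul (hc.pderiv (i := 1)) |>.sub
        ((hc.pderiv (i := 0)).mul (hq.pderiv (i := 1))))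
    exact this
  · linear_combination C (1 / 3) * (pderiv 0 q * ec - pderiv 0 c * eq) +
      (pderiv 0 q * c - q * pderiv 0 c) * h3
  · linear_combination C (1 / 3) * (pderiv 1 q * ec - pderiv 1 c * eq) +
      (pderiv 1 q * c - q * pderiv 1 c) * h3

/-- For `h = c m_j`, the right-hand side is `(q_i c - q c_i) m_j - q c ∂_i m_j`. The first term is
`w (t, -s) m_j = w (s t ∂m_j - s² ∂m_(j+1))`, which gives the coefficients. -/
lemma mul_monom_castSucc (hq : q.IsHomogeneous 3) {c : MvPolynomial (Fin 2) ℂ}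
    (hc : c.IsHomogeneous 3) (j : Fin (d + 1)) :
    HasSexticRelation d q (c * monom d (X 0) (X 1) j.castSucc) := by
  obtain ⟨w, hw, e0, e1⟩ := exists_wronskian hq hc
  refine ⟨(Pi.single j.castSucc (X 0 * X 1 * w - q * c) : Fin (d + 2) → MvPolynomial (Fin 2) ℂ) +
    Pi.single j.succ (-(X 0 ^ 2 * w)),
    fun k => ?_, ?_, ?_⟩
  · have h1 : (X 0 * X 1 * w - q * c).IsHomogeneous 6 :=
      (((isHomogeneous_X ℂ 0).mul (isHomogeneous_X ℂ 1)).mul hw).sub (hq.mul hc)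
    have h2 : (-(X 0 ^ 2 * w)).IsHomogeneous 6 := ((isHomogeneous_X_pow 0 2).mul hw).neg
    rw [Pi.add_apply, Pi.single_apply, Pi.single_apply]
    refine IsHomogeneous.add ?_ ?_ <;> split_ifs <;>
      first | assumption | exact isHomogeneous_zero _ _ _
  · have := monomDerivS_castSucc_sub_succ d (X 0 : MvPolynomial (Fin 2) ℂ) (X 1) j
    simp only [Pi.add_apply, add_mul, Finset.sum_add_distrib, Pi.single_apply, ite_mul, zero_mul,
      Finset.sum_ite_eq', Finset.mem_univ, if_true, pderiv_mul, pderiv_zero_monom]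
    linear_combination w * this + monom d (X 0) (X 1) j.castSucc * e0
  · have := monomDerivT_castSucc_sub_succ d (X 0 : MvPolynomial (Fin 2) ℂ) (X 1) j
    simp only [Pi.add_apply, add_mul, Finset.sum_add_distrib, Pi.single_apply, ite_mul, zero_mul,
      Finset.sum_ite_eq', Finset.mem_univ, if_true, pderiv_mul, pderiv_one_monom]
    linear_combination w * this + monom d (X 0) (X 1) j.castSucc * e1

/-- The same computation using `t² ∂m_j - s t ∂m_(j+1) = (t, -s) m_(j+1)`. This version reaches the
last monomial `t ^ (d + 1)`. -/
lemma mul_monom_succ (hq : q.IsHomogeneous 3) {c : MvPolynomial (Fin 2) ℂ}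
    (hc : c.IsHomogeneous 3) (j : Fin (d + 1)) :
    HasSexticRelation d q (c * monom d (X 0) (X 1) j.succ) := by
  obtain ⟨w, hw, e0, e1⟩ := exists_wronskian hq hc
  refine ⟨(Pi.single j.castSucc (X 1 ^ 2 * w) : Fin (d + 2) → MvPolynomial (Fin 2) ℂ) +
    (Pi.single j.succ (-(X 0 * X 1 * w + q * c)) : Fin (d + 2) → MvPolynomial (Fin 2) ℂ),
    fun k => ?_, ?_, ?_⟩
  · have h1 : (-(X 0 * X 1 * w + q * c)).IsHomogeneous 6 :=
      ((((isHomogeneous_X ℂ 0).mul (isHomogeneous_X ℂ 1)).mul hw).add (hq.mul hc)).neg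
    have h2 : (X 1 ^ 2 * w : MvPolynomial (Fin 2) ℂ).IsHomogeneous 6 :=
      (isHomogeneous_X_pow 1 2).mul hw
    rw [Pi.add_apply, Pi.single_apply, Pi.single_apply]
    refine IsHomogeneous.add ?_ ?_ <;> split_ifs <;>
      first | assumption | exact isHomogeneous_zero _ _ _
  · have h1 := monomDerivS_castSucc_sub_succ d (X 0 : MvPolynomial (Fin 2) ℂ) (X 1) j
    have h2 := _root_.mul_monom_succ d (X 0 : MvPolynomial (Fin 2) ℂ) (X 1) j
    simp only [Pi.add_apply, add_mul, Finset.sum_add_distrib, Pi.single_apply, ite_mul, zero_mul,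
      Finset.sum_ite_eq', Finset.mem_univ, if_true, pderiv_mul, pderiv_zero_monom]
    -- The identity just used is `t / s` times the one for `m_j`, so it is verified after
    -- multiplication by `s`.
    refine mul_left_cancel₀ (X_ne_zero (0 : Fin 2)) ?_
    linear_combination X 1 * w * h1 - X 1 * w * h2 + X 0 * monom d (X 0) (X 1) j.succ * e0
  · have h1 := monomDerivT_castSucc_sub_succ d (X 0 : MvPolynomial (Fin 2) ℂ) (X 1) j
    have h2 := _root_.mul_monom_succ d (X 0 : MvPolynomial (Fin 2) ℂ) (X 1) j
    simp only [Pi.add_apply, add_mul, Finset.sum_add_distrib, Pi.single_apply, ite_mul, zero_mul,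
      Finset.sum_ite_eq', Finset.mem_univ, if_true, pderiv_mul, pderiv_one_monom]
    refine mul_left_cancel₀ (X_ne_zero (0 : Fin 2)) ?_
    linear_combination X 1 * w * h1 + X 0 * w * h2 + X 0 * monom d (X 0) (X 1) j.succ * e1

end HasSexticRelation

/-- The form `∑ i, b i * s ^ (n - i) * t ^ i` of degree `n`. -/
def binaryForm {n : ℕ} (b : Fin (n + 1) → ℂ) : MvPolynomial (Fin 2) ℂ :=
  ∑ i : Fin (n + 1), C (b i) * (X 0 ^ (n - (i : ℕ)) * X 1 ^ (i : ℕ))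

lemma isHomogeneous_binaryForm {n : ℕ} (b : Fin (n + 1) → ℂ) :
    (binaryForm b).IsHomogeneous n := by
  refine IsHomogeneous.sum _ _ _ fun i _ => ?_
  have h := (isHomogeneous_C (Fin 2) (b i)).mul (isHomogeneous_X_pow_mul (n - i) i)
  rwa [show 0 + (n - (i : ℕ) + i) = n by omega] at h

lemma eval_binaryForm {n : ℕ} (b : Fin (n + 1) → ℂ) (v : Fin 2 → ℂ) :
    eval v (binaryForm b) = b ⬝ᵥ veronese n v := by
  simp [binaryForm, veronese, dotProduct]

/-- Every binary form of degree `n` is a combination of the monomials. -/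
lemma exists_binaryForm {n : ℕ} {f : MvPolynomial (Fin 2) ℂ} (hf : f.IsHomogeneous n) :
    ∃ b : Fin (n + 1) → ℂ, binaryForm b = f := by
  let φ : (Fin (n + 1) → ℂ) →ₗ[ℂ] MvPolynomial (Fin 2) ℂ :=
    { toFun := binaryForm
      map_add' := fun b b' => by simp [binaryForm, add_mul, Finset.sum_add_distrib]
      map_smul' := fun c b => by
        simp [binaryForm, smul_eq_C_mul, Finset.mul_sum, mul_assoc] }
  have : f ∈ LinearMap.range φ := by
    rw [f.as_sum]
    refine Submodule.sum_mem _ fun m hm => ?_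
    have hd : m 0 + m 1 = n := by
      have := hf (mem_support_iff.mp hm)
      simpa [Finsupp.weight_apply, Finsupp.sum_fintype] using this
    refine ⟨Pi.single ⟨m 1, by omega⟩ (coeff m f), ?_⟩
    change binaryForm _ = _
    rw [binaryForm, Finset.sum_eq_single ⟨m 1, by omega⟩, monomial_eq, Finsupp.prod_fintype]
    · simp only [Pi.single_eq_same, Fin.prod_univ_two]
      rw [show n - m 1 = m 0 by omega]
    · simp
    · intro i _ hi
      simp [hi]
    · simp
  exact this

/-- The relation is linear in `h`, and each monomial of degree `d + 4` is `s³ m_i` or a cubic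
monomial times `t ^ (d + 1)`. -/
lemma hasSexticRelation_binaryForm {d : ℕ} {q : MvPolynomial (Fin 2) ℂ} (hq : q.IsHomogeneous 3)
    (b : Fin (d + 4 + 1) → ℂ) : HasSexticRelation d q (binaryForm b) := by
  refine Finset.sum_induction _ _ (fun _ _ => .add) .zero fun i _ => .const_mul _ ?_
  obtain ⟨i, hi⟩ := i
  rcases Nat.lt_or_ge i (d + 1) with h | h
  · have := HasSexticRelation.mul_monom_castSucc hq (isHomogeneous_X_pow (R := ℂ) 0 3) ⟨i, h⟩
    convert this using 1
    simp only [monom, Fin.val_castSucc]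
    rw [show d + 4 - i = 3 + (d + 1 - i) by omega]
    ring
  · have hc := isHomogeneous_X_pow_mul (d + 4 - i) (i - (d + 1))
    rw [show d + 4 - i + (i - (d + 1)) = 3 by omega] at hc
    have := HasSexticRelation.mul_monom_succ hq hc (Fin.last d)
    convert this using 1
    simp only [monom, Fin.val_succ, Fin.val_last, Nat.sub_self, pow_zero, one_mul]
    rw [mul_assoc, ← pow_add, show i - (d + 1) + (d + 1) = i by omega]

end Relations

/-! ### Splitting type of a curve with coordinate forms `q * m_j` and `h` -/

section Splitting

open MvPolynomial

/-- Forms without common zero on `ℙ¹` generate the unit ideal on every chart. -/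
lemma exists_bezout {f : Fin 3 → MvPolynomial (Fin 2) ℂ}
    (hf : ∀ v : Fin 2 → ℂ, v ≠ 0 → ∃ i, eval v (f i) ≠ 0) {R : Type*} [CommRing R] [Algebra ℂ R]
    (φ : MvPolynomial (Fin 2) ℂ →ₐ[ℂ] R) (hφ : IsCoprime (φ (X 0)) (φ (X 1))) :
    ∃ c : Fin 3 → R, c 0 * φ (f 0) + c 1 * φ (f 1) + c 2 * φ (f 2) = 1 := by
  -- Nullstellensatz: the only possible common zero is the origin, so powers of both variables lie
  -- in the ideal.
  have hrad : ∀ k : Fin 2, X k ∈ (Ideal.span (Set.range f)).radical := by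
    intro k
    rw [← vanishingIdeal_zeroLocus_eq_radical (K := ℂ), mem_vanishingIdeal_iff]
    intro v hv
    have hv0 : v = 0 := by
      by_contra h
      obtain ⟨i, hi⟩ := hf v h
      have := hv (f i) (Ideal.subset_span ⟨i, rfl⟩)
      rw [aeval_eq_eval] at this
      exact hi this
    simp [hv0]
  obtain ⟨k, hk⟩ := hrad 0
  obtain ⟨l, hl⟩ := hrad 1
  obtain ⟨a, b, hab⟩ := hφ.pow (m := k) (n := l)
  have hk' := Ideal.mem_map_of_mem φ hk
  have hl' := Ideal.mem_map_of_mem φ hl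
  have h1 := Ideal.add_mem _ (Ideal.mul_mem_left _ a hk') (Ideal.mul_mem_left _ b hl')
  rw [map_pow, map_pow, hab, Ideal.map_span, ← Set.range_comp, Ideal.mem_span_range_iff_exists_fun]
    at h1
  obtain ⟨c, hc⟩ := h1
  exact ⟨c, by simpa [Fin.sum_univ_three] using hc⟩

lemma secondDiffMatrix_map {R S : Type*} [CommRing R] [CommRing S] (φ : R →+* S) (d : ℕ) (s t : R) :
    (secondDiffMatrix d s t).map φ = secondDiffMatrix d (φ s) (φ t) := by
  ext r j
  simp only [secondDiffMatrix, Matrix.map_apply, Matrix.of_apply, Pi.add_apply, Pi.single_apply,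
    map_add, apply_ite φ, map_mul, map_pow, map_neg, map_ofNat, map_zero]

lemma relationMatrix_map {R S : Type*} [CommRing R] [CommRing S] (φ : R →+* S) (d : ℕ) (s t q : R)
    (g : Fin (d + 2) → R) :
    (relationMatrix d s t q g).map φ = relationMatrix d (φ s) (φ t) (φ q) (φ ∘ g) := by
  rw [relationMatrix, Matrix.fromBlocks_map, secondDiffMatrix_map, relationMatrix]
  congr 1
  · exact Matrix.map_zero _ (map_zero φ)
  · ext i j
    simp

/-- The coordinate forms `q * m_j` and `h`, with `m_j` the monomials of degree `d + 1`. -/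
def adaptedForm (d : ℕ) (q h : MvPolynomial (Fin 2) ℂ) :
    Fin (d + 2) ⊕ Fin 1 → MvPolynomial (Fin 2) ℂ :=
  Sum.elim (fun j => q * monom d (X 0) (X 1) j) fun _ => h

lemma pderiv_adaptedForm_map {R : Type*} [CommRing R] (φ : MvPolynomial (Fin 2) ℂ →+* R) (d : ℕ)
    (q h : MvPolynomial (Fin 2) ℂ) :
    (Matrix.of fun k i => pderiv i (adaptedForm d q h k)).map φ =
      adaptedJacobian d (φ (X 0)) (φ (X 1)) (φ q) (φ (pderiv 0 q)) (φ (pderiv 1 q))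
        (φ (pderiv 0 h)) (φ (pderiv 1 h)) := by
  ext (j | j) i
  · fin_cases i
    · simp [adaptedForm, adaptedJacobian, pderiv_zero_monom, map_monom, map_monomDerivS]
      ring
    · simp [adaptedForm, adaptedJacobian, pderiv_one_monom, map_monom, map_monomDerivT]
      ring
  · fin_cases i <;> simp [adaptedForm, adaptedJacobian]

lemma isHomogeneous_relationMatrix {d : ℕ} {q : MvPolynomial (Fin 2) ℂ} (hq : q.IsHomogeneous 3)
    {g : Fin (d + 2) → MvPolynomial (Fin 2) ℂ} (hg : ∀ j, (g j).IsHomogeneous 6)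
    (k : Fin d ⊕ Fin 1) (j : Fin (d + 2) ⊕ Fin 1) :
    (relationMatrix d (X 0) (X 1) q g k j).IsHomogeneous
      (Sum.elim (fun _ => 2) (fun _ => 6) k) := by
  rcases k with k | k <;> rcases j with j | j
  · have h0 : (X 1 ^ 2 : MvPolynomial (Fin 2) ℂ).IsHomogeneous 2 := isHomogeneous_X_pow 1 2
    have h1 : (-2 * X 0 * X 1 : MvPolynomial (Fin 2) ℂ).IsHomogeneous 2 := by
      have := ((isHomogeneous_C (Fin 2) (-2 : ℂ)).mul (isHomogeneous_X ℂ 0)).mul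
        (isHomogeneous_X ℂ 1)
      rwa [map_neg, map_ofNat] at this
    have h2 : (X 0 ^ 2 : MvPolynomial (Fin 2) ℂ).IsHomogeneous 2 := isHomogeneous_X_pow 0 2
    have key : ∀ (p : Prop) [Decidable p] {f : MvPolynomial (Fin 2) ℂ}, f.IsHomogeneous 2 →
        (if p then f else 0).IsHomogeneous 2 := by
      intro p _ f hf
      by_cases hp : p
      · rwa [if_pos hp]
      · rw [if_neg hp]
        exact isHomogeneous_zero _ _ _
    simp only [relationMatrix, Matrix.fromBlocks_apply₁₁, secondDiffMatrix, Matrix.of_apply,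
      Pi.add_apply, Pi.single_apply, Sum.elim_inl]
    exact ((key _ h0).add (key _ h1)).add (key _ h2)
  · rw [relationMatrix, Matrix.fromBlocks_apply₁₂, Matrix.zero_apply]
    exact isHomogeneous_zero _ _ _
  · simpa only [relationMatrix, Matrix.fromBlocks_apply₂₁, Matrix.of_apply, Sum.elim_inr] using hg j
  · simpa only [relationMatrix, Matrix.fromBlocks_apply₂₂, Matrix.of_apply, Sum.elim_inr] using
      hq.pow 2

/-- A curve whose coordinate forms are, up to a linear change of coordinates, the forms `q * m_j`
with `q` a cubic form, and one further form `h`, such that the zeros of `q` are simple and are not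
zeros of `h`. -/
theorem RationalCurve.hasSplittingType_normalSheaf {d : ℕ} {κ : Type} [Fintype κ] [DecidableEq κ]
    (F : RationalCurve (d + 4) κ) {q : MvPolynomial (Fin 2) ℂ} (hq : q.IsHomogeneous 3)
    (b : Fin (d + 4 + 1) → ℂ) (e : (κ → ℂ) ≃ₗ[ℂ] (Fin (d + 2) ⊕ Fin 1 → ℂ))
    (hF : ∀ k, adaptedForm d q (binaryForm b) k =
      ∑ j, C (LinearMap.toMatrix' e.toLinearMap k j) * F.form j)
    (hsimple : ∀ v : Fin 2 → ℂ, v ≠ 0 → eval v q = 0 →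
      eval v (binaryForm b) ≠ 0 ∧ ∃ i, eval v (pderiv i q) ≠ 0) :
    F.normalSheaf.HasSplittingType
      (Sum.elim (fun _ : Fin d => ((d + 4 : ℕ) : ℤ) + 2)
        (fun _ : Fin 1 => ((d + 4 : ℕ) : ℤ) + 6)) := by
  set h := binaryForm b with hh
  obtain ⟨g, hg, hgS, hgT⟩ := hasSexticRelation_binaryForm hq b
  rw [← hh] at hgS hgT
  set P := LinearMap.toMatrix' e.toLinearMap with hP
  set P' := LinearMap.toMatrix' e.symm.toLinearMap with hP'
  have hPP' : P * P' = 1 := by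
    rw [hP, hP', ← LinearMap.toMatrix'_comp, LinearEquiv.comp_symm, LinearMap.toMatrix'_id]
  have hP'P : P' * P = 1 := by
    rw [hP, hP', ← LinearMap.toMatrix'_comp, LinearEquiv.symm_comp, LinearMap.toMatrix'_id]
  set J : Matrix κ (Fin 2) (MvPolynomial (Fin 2) ℂ) :=
    Matrix.of fun j i => pderiv i (F.form j) with hJ
  set Q : Matrix (Fin (d + 2) ⊕ Fin 1) κ (MvPolynomial (Fin 2) ℂ) := P.map C with hQ
  have hJ' : (Matrix.of fun k i => pderiv i (adaptedForm d q h k)) = Q * J := by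
    ext1 k i
    simp only [Matrix.of_apply, hF, map_sum, pderiv_C_mul, Matrix.mul_apply,
      Matrix.map_apply, hJ, hQ]
  -- The relations are written in adapted coordinates; `Q` carries them to the given ones and stays
  -- invertible over every algebra.
  set G : Matrix (Fin d ⊕ Fin 1) κ (MvPolynomial (Fin 2) ℂ) :=
    relationMatrix d (X 0) (X 1) q g * Q with hG
  have hmap : ∀ (R : Type) [CommRing R] [Algebra ℂ R] (φ : MvPolynomial (Fin 2) ℂ →ₐ[ℂ] R)
      {m n : Type} (M : Matrix m n ℂ), (M.map C).map φ = M.map (algebraMap ℂ R) := by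
    intro R _ _ φ m n M
    ext i j
    simp
  have hGmap : ∀ (R : Type) [CommRing R] [Algebra ℂ R] (φ : MvPolynomial (Fin 2) ℂ →ₐ[ℂ] R),
      G.map φ = relationMatrix d (φ (X 0)) (φ (X 1)) (φ q) (φ ∘ g) * P.map (algebraMap ℂ R) := by
    intro R _ _ φ
    rw [hG, Matrix.map_mul, hQ, hmap]
    congr 1
    exact relationMatrix_map (φ : MvPolynomial (Fin 2) ℂ →+* R) d _ _ q g
  have hJmap : ∀ (R : Type) [CommRing R] [Algebra ℂ R] (φ : MvPolynomial (Fin 2) ℂ →ₐ[ℂ] R),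
      adaptedJacobian d (φ (X 0)) (φ (X 1)) (φ q) (φ (pderiv 0 q)) (φ (pderiv 1 q))
        (φ (pderiv 0 h)) (φ (pderiv 1 h)) = P.map (algebraMap ℂ R) * J.map φ := by
    intro R _ _ φ
    rw [← hmap R φ, ← hQ, ← Matrix.map_mul, ← hJ']
    exact (pderiv_adaptedForm_map (φ : MvPolynomial (Fin 2) ℂ →+* R) d q h).symm
  have hinv : ∀ (R : Type) [CommRing R] [Algebra ℂ R],
      P'.map (algebraMap ℂ R) * P.map (algebraMap ℂ R) = 1 := by
    intro R _ _
    rw [← Matrix.map_mul, hP'P, Matrix.map_one _ (map_zero _) (map_one _)]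
  have hinv' : ∀ (R : Type) [CommRing R] [Algebra ℂ R],
      P.map (algebraMap ℂ R) * P'.map (algebraMap ℂ R) = 1 := by
    intro R _ _
    rw [← Matrix.map_mul, hPP', Matrix.map_one _ (map_zero _) (map_one _)]
  have hgS' : ∀ (R : Type) [CommRing R] [Algebra ℂ R] (φ : MvPolynomial (Fin 2) ℂ →ₐ[ℂ] R),
      ∑ j, (φ ∘ g) j * monomDerivS d (φ (X 0)) (φ (X 1)) j =
        φ (pderiv 0 q) * φ h - φ q * φ (pderiv 0 h) := by
    intro R _ _ φ
    rw [← map_mul, ← map_mul, ← map_sub, ← hgS, map_sum]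
    refine Finset.sum_congr rfl fun j _ => ?_
    rw [map_mul]
    exact congrArg (φ (g j) * ·)
      (map_monomDerivS (φ : MvPolynomial (Fin 2) ℂ →+* R) d (X 0) (X 1) j).symm
  have hgT' : ∀ (R : Type) [CommRing R] [Algebra ℂ R] (φ : MvPolynomial (Fin 2) ℂ →ₐ[ℂ] R),
      ∑ j, (φ ∘ g) j * monomDerivT d (φ (X 0)) (φ (X 1)) j =
        φ (pderiv 1 q) * φ h - φ q * φ (pderiv 1 h) := by
    intro R _ _ φ
    rw [← map_mul, ← map_mul, ← map_sub, ← hgT, map_sum]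
    refine Finset.sum_congr rfl fun j _ => ?_
    rw [map_mul]
    exact congrArg (φ (g j) * ·)
      (map_monomDerivT (φ : MvPolynomial (Fin 2) ℂ →+* R) d (X 0) (X 1) j).symm
  have hbez : ∀ (R : Type) [CommRing R] [Algebra ℂ R] (φ : MvPolynomial (Fin 2) ℂ →ₐ[ℂ] R),
      IsCoprime (φ (X 0)) (φ (X 1)) → ∃ c : Fin 3 → R,
        c 0 * (φ (pderiv 0 q) * φ h - φ q * φ (pderiv 0 h)) +
        c 1 * (φ (pderiv 1 q) * φ h - φ q * φ (pderiv 1 h)) + c 2 * φ q ^ 2 = 1 := by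
    intro R _ _ φ hφ
    have := exists_bezout (f := ![pderiv 0 q * h - q * pderiv 0 h,
      pderiv 1 q * h - q * pderiv 1 h, q ^ 2]) ?_ φ hφ
    · simpa using this
    · intro v hv
      by_contra! hz
      have h0 := hz 0
      have h1 := hz 1
      have h2 := hz 2
      simp only [Matrix.cons_val_zero, Matrix.cons_val_one, Matrix.cons_val, map_sub, map_mul,
        map_pow] at h0 h1 h2
      -- At a common zero `q² = 0`, so the other two forms reduce to `q_i h`; simplicity of the root
      -- and `h ≠ 0` exclude this.
      have hq0 : eval v q = 0 := eq_zero_of_pow_eq_zero h2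
      obtain ⟨hv1, i, hi⟩ := hsimple v hv hq0
      rw [hq0, zero_mul, sub_zero] at h0 h1
      fin_cases i
      · exact mul_ne_zero hi hv1 h0
      · exact mul_ne_zero hi hv1 h1
  have hcast : ∀ (R : Type) [CommRing R] [Algebra ℂ R] (m : ℕ),
      ((d : R) + (m + 1 : ℕ)) * algebraMap ℂ R ((d + (m + 1 : ℕ) : ℂ)⁻¹) = 1 := by
    intro R _ _ m
    have : ((d : R) + (m + 1 : ℕ)) = algebraMap ℂ R (d + (m + 1 : ℕ) : ℂ) := by simp
    rw [this, ← map_mul, mul_inv_cancel₀ (by norm_cast), map_one]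
  refine SheafP1.hasSplittingType_coker_ofForms _ _ _ _ _
    (Sum.elim (fun _ : Fin d => 2) fun _ : Fin 1 => 6) ?_ _ _ G ?_ ?_ ?_
  · rintro (j | j) <;> rfl
  · intro k i
    rw [hG, Matrix.mul_apply]
    refine IsHomogeneous.sum _ _ _ fun j _ => ?_
    exact (isHomogeneous_relationMatrix hq hg k j).mul (isHomogeneous_C _ (P j i))
  · intro R _ _ φ hφ
    obtain ⟨c, hc⟩ := hbez R φ hφ
    have e1 := euler_two hq
    have e2 := euler_two (isHomogeneous_binaryForm b)
    have key := ker_relationMatrix (g := φ ∘ g) (c := c) (h := φ h) hφ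
      (D := algebraMap ℂ R ((d + (0 + 1 : ℕ) : ℂ)⁻¹))
      (E := algebraMap ℂ R ((d + (3 + 1 : ℕ) : ℂ)⁻¹))
      (by simpa using hcast R 0) (by have := hcast R 3; norm_num at this ⊢; exact this)
      (by rw [← map_mul, ← map_mul, ← map_add, e1, map_mul, map_natCast]; norm_num)
      (by rw [← map_mul, ← map_mul, ← map_add, e2, map_mul, map_natCast, ← hh]; norm_num)
      (hgS' R φ) (hgT' R φ) hc
    rw [hJmap] at key
    change LinearMap.ker (G.map φ).mulVecLin = LinearMap.range (J.map φ).mulVecLin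
    apply le_antisymm
    · intro x hx
      rw [LinearMap.mem_ker, hGmap, Matrix.mulVecLin_mul, LinearMap.comp_apply, ← LinearMap.mem_ker,
        key] at hx
      obtain ⟨w, hw⟩ := hx
      refine ⟨w, ?_⟩
      have := congrArg (P'.map (algebraMap ℂ R)).mulVec hw
      simpa [Matrix.mulVec_mulVec, ← Matrix.mul_assoc, hinv] using this
    · rintro _ ⟨w, rfl⟩
      have hx : (P.map (algebraMap ℂ R) * J.map φ).mulVecLin w ∈
        LinearMap.range (P.map (algebraMap ℂ R) * J.map φ).mulVecLin := ⟨w, rfl⟩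
      rw [← key, LinearMap.mem_ker, Matrix.mulVecLin_apply, Matrix.mulVecLin_apply,
        Matrix.mulVec_mulVec, ← Matrix.mul_assoc, ← hGmap] at hx
      rw [LinearMap.mem_ker, Matrix.mulVecLin_apply, Matrix.mulVecLin_apply, Matrix.mulVec_mulVec,
        hx]
  · intro R _ _ φ hφ
    obtain ⟨c, hc⟩ := hbez R φ hφ
    have key := relationMatrix_surjective (g := φ ∘ g) (c := c) hφ (hgS' R φ) (hgT' R φ) hc
    intro y
    obtain ⟨z, hz⟩ := key y
    refine ⟨(P'.map (algebraMap ℂ R)).mulVec z, ?_⟩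
    rw [hGmap, Matrix.mulVec_mulVec, Matrix.mul_assoc, hinv', Matrix.mul_one, hz]

end Splitting

/-! ### Points of the rational normal curve and the cubic through three of them -/

section Geometry

open MvPolynomial

lemma binaryForm_injective {n : ℕ} {b : Fin (n + 1) → ℂ} (h : binaryForm b = 0) : b = 0 := by
  have h1 := congrArg (fun f => aeval (R := ℂ) ![1, (Polynomial.X : ℂ[X])] f) h
  ext i
  have h2 := congrArg (fun f : ℂ[X] => f.coeff i) h1
  simpa [binaryForm, Polynomial.finsetSum_coeff, Polynomial.coeff_C_mul, Polynomial.coeff_X_pow,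
    Fin.val_inj, algebraMap_eq] using h2

lemma veronese_smul (n : ℕ) (c : ℂ) (v : Fin 2 → ℂ) :
    veronese n (c • v) = c ^ n • veronese n v := by
  ext i
  simp only [veronese, Pi.smul_apply, smul_eq_mul]
  rw [mul_pow, mul_pow, show c ^ n = c ^ (n - (i : ℕ)) * c ^ (i : ℕ) by
    rw [← pow_add]; congr 1; omega]
  ring

/-- The homogeneous coordinates of three points are pairwise not proportional. -/
def PairwiseDistinct (p : Fin 3 → Fin 2 → ℂ) : Prop :=
  ∀ k l, k ≠ l → p k 1 * p l 0 - p k 0 * p l 1 ≠ 0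

lemma exists_smul_of_det_eq_zero {v w : Fin 2 → ℂ} (hv : v ≠ 0) (hw : w ≠ 0)
    (h : w 1 * v 0 - w 0 * v 1 = 0) : ∃ c : ℂ, c ≠ 0 ∧ v = c • w := by
  have hex : ∃ c : ℂ, v = c • w := by
    by_cases h0 : w 0 = 0
    · have h1 : w 1 ≠ 0 := fun h1 => hw (by ext i; fin_cases i <;> simpa)
      refine ⟨v 1 / w 1, ?_⟩
      have hv0 : v 0 = 0 := by simpa [h0, h1] using h
      ext i
      fin_cases i
      · simp [h0, hv0]
      · simp [h1]
    · refine ⟨v 0 / w 0, ?_⟩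
      ext i
      fin_cases i
      · simp [h0]
      · simp only [Fin.mk_one, Pi.smul_apply, smul_eq_mul]
        field_simp
        linear_combination -h
  obtain ⟨c, hc⟩ := hex
  refine ⟨c, ?_, hc⟩
  rintro rfl
  exact hv (by simpa using hc)

lemma exists_points {n r : ℕ} {M : Submodule ℂ (Fin (n + 1) → ℂ)} (hM : IsSecantSpace n r M) :
    ∃ p : Fin r → Fin 2 → ℂ, (∀ k, p k ≠ 0) ∧
      (∀ k l, k ≠ l → p k 1 * p l 0 - p k 0 * p l 1 ≠ 0) ∧
      M = Submodule.span ℂ (Set.range fun k => veronese n (p k)) := by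
  obtain ⟨-, P, hP, hPC, rfl⟩ := hM
  let ψ := (Finset.equivFinOfCardEq hP).symm
  choose p hp0 hp using fun k => hPC (ψ k).2
  refine ⟨p, hp0, ?_, ?_⟩
  · intro k l hkl hdet
    obtain ⟨c, hc, hpl⟩ := exists_smul_of_det_eq_zero (hp0 l) (hp0 k) hdet
    apply hkl
    apply ψ.injective
    apply Subtype.ext
    apply Projectivization.submodule_injective
    rw [hp k, hp l, hpl, veronese_smul, Submodule.span_singleton_smul_eq (pow_ne_zero n hc).isUnit]
  · rw [Submodule.span_range_eq_iSup, iSup_subtype', ← ψ.iSup_comp]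
    exact iSup_congr hp

/-- Three points of a rational normal curve of degree at least two are linearly independent. -/
lemma eq_zero_of_sum_veronese {p : Fin 3 → Fin 2 → ℂ} (hp0 : ∀ k, p k ≠ 0)
    (hp : PairwiseDistinct p) (m : ℕ) (y : Fin 3 → ℂ)
    (hy : ∑ k, y k • veronese (m + 2) (p k) = 0) : y = 0 := by
  -- degree two
  have two : ∀ z : Fin 3 → ℂ, ∑ k, z k * p k 0 ^ 2 = 0 → ∑ k, z k * (p k 0 * p k 1) = 0 →
      ∑ k, z k * p k 1 ^ 2 = 0 → ∀ k, z k = 0 := by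
    intro z h0 h1 h2 k
    have key : ∀ k a b, k ≠ a → k ≠ b → (∀ f : Fin 3 → ℂ, ∑ i, f i = f k + f a + f b) →
        z k = 0 := by
      intro k a b ha hb hsum
      rw [hsum] at h0 h1 h2
      -- The relation is paired with the quadratic form that is the product of the linear forms
      -- vanishing at `p a` and `p b`; only the `k` term survives.
      have : z k * ((p k 1 * p a 0 - p k 0 * p a 1) * (p k 1 * p b 0 - p k 0 * p b 1)) = 0 := by
        linear_combination p a 1 * p b 1 * h0 - (p a 1 * p b 0 + p a 0 * p b 1) * h1 +
          p a 0 * p b 0 * h2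
      exact (mul_eq_zero.mp this).resolve_right (mul_ne_zero (hp _ _ ha) (hp _ _ hb))
    fin_cases k
    · exact key 0 1 2 (by decide) (by decide) fun f => by rw [Fin.sum_univ_three]
    · exact key 1 0 2 (by decide) (by decide) fun f => by rw [Fin.sum_univ_three]; ring
    · exact key 2 0 1 (by decide) (by decide) fun f => by rw [Fin.sum_univ_three]; ring
  have hcoord : ∀ i (_ : i ≤ m + 2), ∑ k, y k * (p k 0 ^ (m + 2 - i) * p k 1 ^ i) = 0 := by
    intro i hi
    have := congrFun hy ⟨i, by omega⟩
    simpa [veronese] using this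
  ext k
  -- The first three coordinates carry the weights `y k * p k 0 ^ m`, the last three `y k * p k 1 ^
  -- m`; both weights vanish, while `p k ≠ 0`.
  have hs := two (fun k => y k * p k 0 ^ m)
    (by rw [← hcoord 0 (by omega)]; refine Finset.sum_congr rfl fun k _ => ?_; simp; ring)
    (by
      rw [← hcoord 1 (by omega)]; refine Finset.sum_congr rfl fun k _ => ?_
      rw [show m + 2 - 1 = m + 1 by omega]; ring)
    (by
      rw [← hcoord 2 (by omega)]; refine Finset.sum_congr rfl fun k _ => ?_
      rw [Nat.add_sub_cancel]; ring) k
  have ht := two (fun k => y k * p k 1 ^ m)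
    (by
      rw [← hcoord m (by omega)]; refine Finset.sum_congr rfl fun k _ => ?_
      rw [Nat.add_sub_cancel_left]; ring)
    (by
      rw [← hcoord (m + 1) (by omega)]; refine Finset.sum_congr rfl fun k _ => ?_
      rw [show m + 2 - (m + 1) = 1 by omega]; ring)
    (by
      rw [← hcoord (m + 2) (by omega)]; refine Finset.sum_congr rfl fun k _ => ?_
      rw [Nat.sub_self]; ring) k
  by_contra hk
  have hs' := eq_zero_of_pow_eq_zero ((mul_eq_zero.mp hs).resolve_left hk)
  have ht' := eq_zero_of_pow_eq_zero ((mul_eq_zero.mp ht).resolve_left hk)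
  exact hp0 k (by ext i; fin_cases i <;> simpa)

/-- The linear form vanishing at the point `v`. -/
def linearFormAt (v : Fin 2 → ℂ) : MvPolynomial (Fin 2) ℂ := C (v 1) * X 0 - C (v 0) * X 1

lemma eval_linearFormAt (v w : Fin 2 → ℂ) :
    eval w (linearFormAt v) = v 1 * w 0 - v 0 * w 1 := by
  simp [linearFormAt]

lemma isHomogeneous_linearFormAt (v : Fin 2 → ℂ) : (linearFormAt v).IsHomogeneous 1 :=
  (((isHomogeneous_C _ (v 1)).mul (isHomogeneous_X ℂ 0))).sub
    ((isHomogeneous_C _ (v 0)).mul (isHomogeneous_X ℂ 1))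

/-- The cubic form vanishing at three points. -/
def cubicFormAt (p : Fin 3 → Fin 2 → ℂ) : MvPolynomial (Fin 2) ℂ := ∏ k, linearFormAt (p k)

lemma isHomogeneous_cubicFormAt (p : Fin 3 → Fin 2 → ℂ) : (cubicFormAt p).IsHomogeneous 3 := by
  have := IsHomogeneous.prod Finset.univ (fun k => linearFormAt (p k)) (fun _ => 1)
    fun k _ => isHomogeneous_linearFormAt (p k)
  simpa [cubicFormAt] using this

lemma eval_cubicFormAt_self (p : Fin 3 → Fin 2 → ℂ) (k : Fin 3) :
    eval (p k) (cubicFormAt p) = 0 := by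
  rw [cubicFormAt, map_prod]
  refine Finset.prod_eq_zero (Finset.mem_univ k) ?_
  rw [eval_linearFormAt]
  ring

lemma exists_smul_of_eval_cubicFormAt {p : Fin 3 → Fin 2 → ℂ} (hp0 : ∀ k, p k ≠ 0)
    {v : Fin 2 → ℂ} (hv : v ≠ 0) (h : eval v (cubicFormAt p) = 0) :
    ∃ k, ∃ c : ℂ, c ≠ 0 ∧ v = c • p k := by
  rw [cubicFormAt, map_prod, Finset.prod_eq_zero_iff] at h
  obtain ⟨k, -, hk⟩ := h
  rw [eval_linearFormAt] at hk
  exact ⟨k, exists_smul_of_det_eq_zero hv (hp0 k) hk⟩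

/-- At a root, only the derivative of the vanishing factor survives in the product rule; its
gradient is `(p k 1, -p k 0)`, and the other factors are nonzero there. -/
lemma exists_pderiv_cubicFormAt_ne_zero {p : Fin 3 → Fin 2 → ℂ} (hp0 : ∀ k, p k ≠ 0)
    (hp : PairwiseDistinct p) (k : Fin 3) {c : ℂ} (hc : c ≠ 0) :
    ∃ i, eval (c • p k) (pderiv i (cubicFormAt p)) ≠ 0 := by
  have hprod : eval (c • p k) (∏ l ∈ Finset.univ.erase k, linearFormAt (p l)) ≠ 0 := by
    rw [map_prod, Finset.prod_ne_zero_iff]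
    intro l hl
    rw [eval_linearFormAt]
    have := mul_ne_zero hc (hp l k (Finset.ne_of_mem_erase hl))
    simpa [mul_sub, mul_left_comm] using this
  have h0 : eval (c • p k) (linearFormAt (p k)) = 0 := by
    rw [eval_linearFormAt]
    simp only [Pi.smul_apply, smul_eq_mul]
    ring
  have hder : ∀ i, eval (c • p k) (pderiv i (cubicFormAt p)) =
      eval (c • p k) (pderiv i (linearFormAt (p k))) *
        eval (c • p k) (∏ l ∈ Finset.univ.erase k, linearFormAt (p l)) := by
    intro i
    rw [cubicFormAt, ← Finset.mul_prod_erase _ _ (Finset.mem_univ k), pderiv_mul, map_add, map_mul,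
      map_mul, h0]
    ring
  by_contra! h
  have h1 := fun i => (mul_eq_zero.mp ((hder i).symm.trans (h i))).resolve_right hprod
  apply hp0 k
  ext i
  fin_cases i
  · simpa [linearFormAt] using h1 1
  · simpa [linearFormAt] using h1 0

lemma cubicFormAt_ne_zero {p : Fin 3 → Fin 2 → ℂ} (hp0 : ∀ k, p k ≠ 0)
    (hp : PairwiseDistinct p) : cubicFormAt p ≠ 0 := by
  intro h
  obtain ⟨i, hi⟩ := exists_pderiv_cubicFormAt_ne_zero hp0 hp 0 one_ne_zero
  rw [h] at hi
  simp at hi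

end Geometry

/-! ### Adapted coordinates for the projection from `L` -/

section Main

open MvPolynomial

lemma mulVec_surjective_of_vecMul {m n : Type*} [Fintype m] [Fintype n] (A : Matrix m n ℂ)
    (h : ∀ c : m → ℂ, Matrix.vecMul c A = 0 → c = 0) : Function.Surjective A.mulVec := by
  have li : LinearIndependent ℂ A.row := Fintype.linearIndependent_iff.mpr fun c hc i => by
    refine congrFun (h c ?_) i
    ext j
    simpa [Matrix.vecMul, dotProduct] using congrFun hc j
  have hr : Module.finrank ℂ (LinearMap.range A.mulVecLin) = Module.finrank ℂ (m → ℂ) := by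
    rw [Module.finrank_fintype_fun_eq_card]
    exact li.rank_matrix
  exact LinearMap.range_eq_top.mp (Submodule.eq_top_of_finrank_eq hr)

/-- A hyperplane of the span of three points of the curve that contains none of them is cut out by
a linear form not vanishing at these points. -/
lemma exists_functional {n : ℕ} {L M : Submodule ℂ (Fin (n + 1) → ℂ)}
    (hL : Module.finrank ℂ L = 2) (hM : Module.finrank ℂ M = 3) (hLM : L ≤ M)
    (hLcurve : AvoidsCurve n L) {p : Fin 3 → Fin 2 → ℂ} (hp0 : ∀ k, p k ≠ 0)
    (hMp : M = Submodule.span ℂ (Set.range fun k => veronese n (p k))) :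
    ∃ b : Fin (n + 1) → ℂ, (∀ x ∈ M, x ∈ L ↔ b ⬝ᵥ x = 0) ∧ ∀ k, b ⬝ᵥ veronese n (p k) ≠ 0 := by
  have hne : ¬ M ≤ L := fun h => by
    have := Submodule.finrank_mono h
    omega
  obtain ⟨x, hxM, hxL⟩ := SetLike.not_le_iff_exists.mp hne
  obtain ⟨η, hηx, hη⟩ := Submodule.exists_le_ker_of_notMem hxL
  have hb : ∀ y, (fun i => η (Pi.single i 1)) ⬝ᵥ y = η y := by
    intro y
    conv_rhs => rw [pi_eq_sum_univ' y]
    simp [dotProduct, mul_comm]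
  have hlt : M ⊓ LinearMap.ker η < M :=
    lt_of_le_of_ne inf_le_left fun h => hηx (by
      have : x ∈ M ⊓ LinearMap.ker η := h.symm ▸ hxM
      exact this.2)
  -- The functional `η` kills `L` but not all of `M`, so `M ⊓ ker η` has dimension at most 2 and
  -- equals `L`.
  have hLeq : L = M ⊓ LinearMap.ker η := by
    refine Submodule.eq_of_le_of_finrank_le (le_inf hLM hη) ?_
    have := Submodule.finrank_lt_finrank_of_lt hlt
    omega
  have hmem : ∀ x ∈ M, x ∈ L ↔ (fun i => η (Pi.single i 1)) ⬝ᵥ x = 0 := by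
    intro x hx
    rw [hb, hLeq, Submodule.mem_inf, LinearMap.mem_ker]
    exact and_iff_right hx
  refine ⟨_, hmem, fun k hk => ?_⟩
  have hvM : veronese n (p k) ∈ M := hMp ▸ Submodule.subset_span ⟨k, rfl⟩
  refine hLcurve (Projectivization.mk ℂ _ (veronese_ne_zero n (hp0 k)))
    ⟨p k, hp0 k, Projectivization.submodule_mk _ _⟩ ?_
  rw [Projectivization.submodule_mk, Submodule.span_singleton_le_iff_mem]
  exact (hmem _ hvM).mpr hk

/-- The coefficient vectors of the forms `q * m_j` and of one further form that does not vanish at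
some zero of `q` are linearly independent. -/
lemma coeffMatrix_surjective {d : ℕ} {p : Fin 3 → Fin 2 → ℂ} (hp0 : ∀ k, p k ≠ 0)
    (hp : PairwiseDistinct p) {b : Fin (d + 4 + 1) → ℂ} (hb : b ⬝ᵥ veronese (d + 4) (p 0) ≠ 0)
    {B : Fin (d + 2) → Fin (d + 4 + 1) → ℂ}
    (hB : ∀ j, binaryForm (B j) = cubicFormAt p * monom d (X 0) (X 1) j) :
    Function.Surjective
      (Matrix.of (Sum.elim B fun _ : Fin 1 => b) : Matrix _ _ ℂ).mulVec := by
  apply mulVec_surjective_of_vecMul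
  intro c hc
  have hev : ∀ v : Fin 2 → ℂ, ∑ j, c (Sum.inl j) * eval v (cubicFormAt p * monom d (X 0) (X 1) j) +
      c (Sum.inr 0) * (b ⬝ᵥ veronese (d + 4) v) = 0 := by
    intro v
    have := congrArg (· ⬝ᵥ veronese (d + 4) v) hc
    simp only [zero_dotProduct, ← Matrix.dotProduct_mulVec] at this
    simp only [← hB, eval_binaryForm]
    rw [← this]
    simp [dotProduct, Matrix.mulVec]
  -- At a root of `q` all the forms `q * m_j` vanish and the further form does not. What remains is
  -- `q` times a form of degree `d + 1`, so that form is 0.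
  have hr : c (Sum.inr 0) = 0 := by
    have := hev (p 0)
    simp only [map_mul, eval_cubicFormAt_self, zero_mul, mul_zero, Finset.sum_const_zero,
      zero_add] at this
    exact (mul_eq_zero.mp this).resolve_right hb
  have hl : cubicFormAt p * binaryForm (fun j : Fin (d + 1 + 1) => c (Sum.inl j)) = 0 := by
    apply MvPolynomial.funext
    intro v
    have := hev v
    rw [hr, zero_mul, add_zero] at this
    rw [map_zero, ← this, binaryForm, Finset.mul_sum, map_sum]
    refine Finset.sum_congr rfl fun j _ => ?_
    simp only [map_mul, eval_C, monom]
    ring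
  have hl' := binaryForm_injective
    ((mul_eq_zero.mp hl).resolve_left (cubicFormAt_ne_zero hp0 hp))
  ext (j | j)
  · exact congrFun hl' j
  · rw [Subsingleton.elim j 0, hr]
    rfl

/-- The forms `q * m_j` and `h` define a surjection `A` with the same kernel `L` as `π`, so the two
maps differ by a linear automorphism of the target coordinates. -/
theorem hasSplittingType_projectedCurve {d : ℕ} (hd : 0 < d + 4)
    {L M : Submodule ℂ (Fin (d + 4 + 1) → ℂ)} (hL : Module.finrank ℂ L = 2) (hLM : L ≤ M)
    (hLcurve : AvoidsCurve (d + 4) L) {p : Fin 3 → Fin 2 → ℂ} (hp0 : ∀ k, p k ≠ 0)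
    (hp : PairwiseDistinct p)
    (hMp : M = Submodule.span ℂ (Set.range fun k => veronese (d + 4) (p k)))
    {b : Fin (d + 4 + 1) → ℂ} (hbL : ∀ x ∈ M, x ∈ L ↔ b ⬝ᵥ x = 0)
    (hb : ∀ k, b ⬝ᵥ veronese (d + 4) (p k) ≠ 0) {κ : Type} [Fintype κ] [DecidableEq κ]
    (π : (Fin (d + 4 + 1) → ℂ) →ₗ[ℂ] (κ → ℂ)) (hπ : IsProjectionFrom L π) :
    (projectedCurve hd hLcurve π hπ).normalSheaf.HasSplittingType
      (Sum.elim (fun _ : Fin d => ((d + 4 : ℕ) : ℤ) + 2)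
        (fun _ : Fin 1 => ((d + 4 : ℕ) : ℤ) + 6)) := by
  have hq := isHomogeneous_cubicFormAt p
  have hBex : ∀ j : Fin (d + 2), ∃ B : Fin (d + 4 + 1) → ℂ,
      binaryForm B = cubicFormAt p * monom d (X 0) (X 1) j := by
    intro j
    have h := hq.mul (isHomogeneous_monom d j)
    rw [show 3 + (d + 1) = d + 4 by omega] at h
    exact exists_binaryForm h
  choose B hB using hBex
  set A : Matrix (Fin (d + 2) ⊕ Fin 1) (Fin (d + 4 + 1)) ℂ :=
    Matrix.of (Sum.elim B fun _ : Fin 1 => b) with hA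
  have hsurj : Function.Surjective A.mulVecLin := coeffMatrix_surjective hp0 hp (hb 0) hB
  have hLA : L ≤ LinearMap.ker A.mulVecLin := by
    intro x hx
    rw [LinearMap.mem_ker, Matrix.mulVecLin_apply]
    ext (j | j)
    · have hMj : ∀ y ∈ M, B j ⬝ᵥ y = 0 := by
        intro y hy
        rw [hMp] at hy
        induction hy using Submodule.span_induction with
        | mem y hy =>
          obtain ⟨k, rfl⟩ := hy
          simp only
          rw [← eval_binaryForm, hB, map_mul, eval_cubicFormAt_self, zero_mul]
        | zero => exact dotProduct_zero _
        | add y z _ _ hy hz => rw [dotProduct_add, hy, hz, add_zero]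
        | smul c y _ hy => rw [dotProduct_smul, hy, smul_zero]
      exact hMj x (hLM hx)
    · exact (hbL x (hLM hx)).mp hx
  -- There are `d + 3` independent forms on a space of dimension `d + 5`, so their kernel has
  -- dimension 2, like `L`.
  have hker : LinearMap.ker π = LinearMap.ker A.mulVecLin := by
    rw [hπ.2]
    refine Submodule.eq_of_le_of_finrank_eq hLA ?_
    have h1 := A.mulVecLin.finrank_range_add_finrank_ker
    rw [LinearMap.range_eq_top.mpr hsurj, finrank_top] at h1
    simp only [Module.finrank_fintype_fun_eq_card, Fintype.card_sum, Fintype.card_fin] at h1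
    omega
  let e : (κ → ℂ) ≃ₗ[ℂ] (Fin (d + 2) ⊕ Fin 1 → ℂ) :=
    (π.quotKerEquivOfSurjective hπ.1).symm.trans
      ((Submodule.quotEquivOfEq _ _ hker).trans (A.mulVecLin.quotKerEquivOfSurjective hsurj))
  have he : ∀ x, e (π x) = A.mulVec x := by
    intro x
    have : (π.quotKerEquivOfSurjective hπ.1).symm (π x) = Submodule.Quotient.mk x := by
      rw [LinearEquiv.symm_apply_eq]
      rfl
    simp only [e, LinearEquiv.trans_apply, this]
    rfl
  refine RationalCurve.hasSplittingType_normalSheaf _ hq b e ?_ ?_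
  · intro k
    have hAk : adaptedForm d (cubicFormAt p) (binaryForm b) k = binaryForm (A k) := by
      rcases k with j | j
      · exact (hB j).symm
      · rfl
    rw [hAk]
    change binaryForm (A k) = ∑ j, C (LinearMap.toMatrix' e.toLinearMap k j) *
      binaryForm fun i => π (Pi.single i 1) j
    simp only [binaryForm, Finset.mul_sum]
    rw [Finset.sum_comm]
    refine Finset.sum_congr rfl fun i _ => ?_
    simp only [← mul_assoc, ← C_mul, ← Finset.sum_mul, ← map_sum]
    have : A k i = ∑ j, LinearMap.toMatrix' e.toLinearMap k j * π (Pi.single i 1) j := by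
      have h1 := congrFun (he (Pi.single i 1)) k
      have h2 := congrFun (LinearMap.toMatrix'_mulVec e.toLinearMap (π (Pi.single i 1))) k
      rw [Matrix.mulVec_single_one] at h1
      exact h1.symm.trans h2.symm
    rw [this]
  · intro v hv hv0
    obtain ⟨k, c, hc, rfl⟩ := exists_smul_of_eval_cubicFormAt hp0 hv hv0
    refine ⟨?_, exists_pderiv_cubicFormAt_ne_zero hp0 hp k hc⟩
    rw [eval_binaryForm, veronese_smul, dotProduct_smul]
    exact mul_ne_zero (pow_ne_zero _ hc) (hb k)

/-! ### The rank of `normalMatrix` -/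

lemma sum_veronese_injective {p : Fin 3 → Fin 2 → ℂ} (hp0 : ∀ k, p k ≠ 0)
    (hp : PairwiseDistinct p) (m : ℕ) {y z : Fin 3 → ℂ}
    (h : ∑ k, y k • veronese (m + 2) (p k) = ∑ k, z k • veronese (m + 2) (p k)) : y = z := by
  rw [← sub_eq_zero]
  apply eq_zero_of_sum_veronese hp0 hp m
  simp only [Pi.sub_apply, sub_smul, Finset.sum_sub_distrib, h, sub_self]

/-- Veronese coordinates are multiplicative: entry `l + i` in degree `d + 4` is entry `i` in degree
2 times entry `l` in degree `d + 2`. Expanding the basis of `L` in the three points therefore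
factors the matrix as `E * V`, and independence of the points in degrees `d + 2` and 2 controls the
factors. -/
theorem rank_normalMatrix {d : ℕ}
    {L M : Submodule ℂ (Fin (d + 4 + 1) → ℂ)} (hLM : L ≤ M) {p : Fin 3 → Fin 2 → ℂ}
    (hp0 : ∀ k, p k ≠ 0) (hp : PairwiseDistinct p)
    (hMp : M = Submodule.span ℂ (Set.range fun k => veronese (d + 4) (p k)))
    {b : Fin (d + 4 + 1) → ℂ} (hbL : ∀ x ∈ M, x ∈ L ↔ b ⬝ᵥ x = 0)
    (hb : ∀ k, b ⬝ᵥ veronese (d + 4) (p k) ≠ 0) {r : ℕ} (a : Module.Basis (Fin r) ℂ L) :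
    (normalMatrix fun j => (a j : Fin (d + 4 + 1) → ℂ)).rank = 3 := by
  have hcoef : ∀ j, ∃ c : Fin 3 → ℂ, ∑ k, c k • veronese (d + 4) (p k) = a j := by
    intro j
    have := hLM (a j).2
    rwa [hMp, Submodule.mem_span_range_iff_exists_fun] at this
  choose c hc using hcoef
  have hvM : ∀ k, veronese (d + 4) (p k) ∈ M := fun k => hMp ▸ Submodule.subset_span ⟨k, rfl⟩
  -- If the `k`-th coefficient vanished on the basis, it would vanish on all of `L`. But `L` meets
  -- the secant line through the points `k` and `l` in a vector whose `k`-th coefficient is the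
  -- value of `b` at the point `l`, which is nonzero.
  have hcne : ∀ k, ∃ j, c j k ≠ 0 := by
    intro k
    by_contra! hk
    obtain ⟨l, hl⟩ : ∃ l, l ≠ k := exists_ne k
    set y : Fin 3 → ℂ := Pi.single k (b ⬝ᵥ veronese (d + 4) (p l)) -
      Pi.single l (b ⬝ᵥ veronese (d + 4) (p k)) with hy
    have hyw : ∑ i, y i • veronese (d + 4) (p i) =
        (b ⬝ᵥ veronese (d + 4) (p l)) • veronese (d + 4) (p k) -
        (b ⬝ᵥ veronese (d + 4) (p k)) • veronese (d + 4) (p l) := by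
      simp [hy, sub_smul, Finset.sum_sub_distrib, Pi.single_apply, ite_smul]
    have hwL : ∑ i, y i • veronese (d + 4) (p i) ∈ L := by
      rw [hbL _ (Submodule.sum_mem _ fun i _ => M.smul_mem _ (hvM i)), hyw, dotProduct_sub,
        dotProduct_smul, dotProduct_smul, smul_eq_mul, smul_eq_mul]
      ring
    have hrepr := congrArg (Subtype.val) (a.sum_repr ⟨_, hwL⟩)
    simp only [Submodule.coe_sum, Submodule.coe_smul, ← hc, Finset.smul_sum, smul_smul] at hrepr
    rw [Finset.sum_comm] at hrepr
    simp only [← Finset.sum_smul] at hrepr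
    have hyk := congrFun (sum_veronese_injective hp0 hp (d + 2) hrepr) k
    simp only [hk, mul_zero, Finset.sum_const_zero, hy, Pi.sub_apply, Pi.single_eq_same,
      Pi.single_eq_of_ne hl.symm, sub_zero] at hyk
    exact hb l hyk.symm
  set V : Matrix (Fin 3) (Fin (d + 2 + 1)) ℂ := Matrix.of fun k => veronese (d + 2) (p k) with hV
  set E : Matrix (Fin r × Fin 3) (Fin 3) ℂ :=
    Matrix.of fun jr k => ![1, -2, 1] jr.2 * (c jr.1 k * veronese 2 (p k) jr.2) with hE
  have hEV : normalMatrix (fun j => (a j : Fin (d + 4 + 1) → ℂ)) = E * V := by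
    ext ⟨j, i⟩ l
    have hl : (l : ℕ) < d + 3 := l.isLt
    have hi := i.isLt
    rw [Matrix.mul_apply, normalMatrix, Matrix.of_apply, ← hc j, Finset.sum_apply, Finset.mul_sum]
    refine Finset.sum_congr rfl fun k _ => ?_
    simp only [hE, hV, Matrix.of_apply, Pi.smul_apply, smul_eq_mul, veronese]
    rw [show d + 4 - ((l : ℕ) + i) = (2 - i) + (d + 2 - l) by omega, pow_add, pow_add]
    ring
  have hVsurj : Function.Surjective V.mulVecLin := by
    refine mulVec_surjective_of_vecMul V fun y hy => eq_zero_of_sum_veronese hp0 hp d y ?_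
    rw [← hy]
    ext i
    simp [Matrix.vecMul, dotProduct, hV]
  have hEinj : Function.Injective E.mulVecLin := by
    rw [← LinearMap.ker_eq_bot, LinearMap.ker_eq_bot']
    intro x hx
    -- A kernel vector of `E` gives, for each `j`, a linear relation between three distinct points
    -- of a conic.
    have hxj : ∀ j, (fun k => c j k * x k) = 0 := by
      intro j
      refine eq_zero_of_sum_veronese hp0 hp 0 _ ?_
      ext i
      have h1 := congrFun hx (j, i)
      simp only [Matrix.mulVecLin_apply, Matrix.mulVec, dotProduct, hE, Matrix.of_apply,
        Pi.zero_apply, mul_assoc, ← Finset.mul_sum] at h1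
      have h2 := (mul_eq_zero.mp h1).resolve_left (by fin_cases i <;> norm_num)
      rw [Finset.sum_apply, Pi.zero_apply, ← h2]
      refine Finset.sum_congr rfl fun k _ => ?_
      simp only [Pi.smul_apply, smul_eq_mul]
      ring
    ext k
    obtain ⟨j, hj⟩ := hcne k
    exact (mul_eq_zero.mp (congrFun (hxj j) k)).resolve_left hj
  rw [hEV, Matrix.rank, Matrix.mulVecLin_mul,
    LinearMap.range_comp_of_range_eq_top _ (LinearMap.range_eq_top.mpr hVsurj),
    LinearMap.finrank_range_of_inj hEinj]
  simp

end Main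

end

theorem mainTheorem4 (n : ℕ) (hn : 4 ≤ n)
    (L : Submodule ℂ (Fin (n + 1) → ℂ)) (hLdim : Module.finrank ℂ L = 2)
    (hLcurve : AvoidsCurve n L)
    (hL3 : ∃ M : Submodule ℂ (Fin (n + 1) → ℂ), IsSecantSpace n 3 M ∧ L ≤ M)
    (hL2 : ¬ IsSecantSpace n 2 L)
    (π : (Fin (n + 1) → ℂ) →ₗ[ℂ] (Fin (n - 1) → ℂ)) (hπ : IsProjectionFrom L π)
    (a : Module.Basis (Fin 2) ℂ L) :
    (projectedCurve (lt_of_lt_of_le (by norm_num) hn) hLcurve π hπ).normalSheaf.HasSplittingType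
        (Sum.elim (fun _ : Fin (n - 4) => (n : ℤ) + 2) (fun _ : Fin 1 => (n : ℤ) + 6)) ∧
      (normalMatrix fun j => (a j : Fin (n + 1) → ℂ)).rank = 3 := by
  obtain ⟨d, rfl⟩ : ∃ d, n = d + 4 := ⟨n - 4, by omega⟩
  obtain ⟨M, hM, hLM⟩ := hL3
  obtain ⟨p, hp0, hp, hMp⟩ := exists_points hM
  obtain ⟨b, hbL, hb⟩ := exists_functional hLdim hM.1 hLM hLcurve hp0 hMp
  exact ⟨hasSplittingType_projectedCurve _ hLdim hLM hLcurve hp0 hp hMp hbL hb π hπ,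
    rank_normalMatrix hLM hp0 hp hMp hbL hb a⟩
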